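/- Let $\Bbbk$ be an algebraically closed field of characteristic $0$ and let $A\in\mathbb Z^{d\times m}$ have columns $a_1,\dots,a_m$ such that $\mathbb ZA=\mathbb Z^d$, the cone $C=\mathbb R_{\ge0}A\subseteq\mathbb R^d$ is strongly convex, and the semigroup $\mathbb NA$ generated by the columns is normal, i.e. $C\cap\mathbb Z^d=\mathbb NA$. For each facet $\sigma$ of $C$ let $F_\sigma$ be its primitive integral support function: the linear form with $F_\sigma(\mathbb Z^d)=\mathbb Z$, $F_\sigma\ge 0$ on all $a_i$, and $F_\sigma(a_i)=0$ for $a_i\in\sigma$. Regard $\Bbbk[\mathbb NA]$ as a subring of $\Bbbk[y_1^{\pm1},\dots,y_d^{\pm1}]$ and let $D_A$ be its ring of $\Bbbk$-linear differential operators in the sense of Grothendieck. Let $\beta_1,\dots,\beta_r\in\mathbb NA$ and $f=(f_1,\dots,f_r)=(y^{\beta_1},\dots,y^{\beta_r})$. Let $D_A$ act by formal differentiation on the module $\Bbbk[y^{\pm1},s_1,\dots,s_r]\prod_i f_i^{s_i}$, let $t_i$ act by $u(s)\prod_j f_j^{s_j}\mapsto u(s_1,\dots,s_i+1,\dots,s_r)\,f_i\prod_j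 f_j^{s_j}$, and put $s_{ij}=s_it_i^{-1}t_j$. The Bernstein--Sato polynomial $b_f(s)\in\Bbbk[s]$ is the monic polynomial of smallest degree for which there are $P_1,\dots,P_r\in D_A[s_{ij}\mid 1\le i,j\le r]$ with $$b_f(s_1+\cdots+s_r)\prod_{i=1}^r f_i^{s_i}=\sum_{l=1}^r P_l\,t_l\prod_{i=1}^r f_i^{s_i}.$$ For a vector $c\in\mathbb Z^r$ write $\ell_\beta(c)=\sum_i c_i\beta_i$, and put $\ell_\beta(s)=\sum_i s_i\beta_i$ and $\binom{p}{n}=p(p-1)\cdots(p-n+1)/n!$. **Proposition.** A polynomial $b\in\Bbbk[s]$ is the Bernstein--Sato polynomial $b_f(s)$ if and only if it is the monic polynomial of smallest degree such that $b(s_1+\cdots+s_r)$ belongs to the ideal of $\Bbbk[s_1,\dots,s_r]$ generated by the polynomials $$g_c(s_1,\dots,s_r)=\prod_{i:\,c_i<0}\binom{s_i}{-c_i}\cdot\prod_{\sigma:\,F_\sigma(\ell_\beta(c))>0}\binom{F_\sigma\big(\ell_\beta(s)+\ell_\beta(c)\big)}{F_\sigma(\ell_\beta(c))},$$ where $c$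 runs over all $c\in\mathbb Z^r$ with $c_1+\cdots+c_r=1$, and $\sigma$ runs over facets of $C$. -/

import Mathlib

open scoped Matrix

noncomputable section

namespace ToricBS

/-! ### The semigroup, its cone, and the facets -/

/-- The semigroup `ℕA ⊆ ℤ^d` generated by the columns of `A`. -/
def semigroup {d m : ℕ} (A : Matrix (Fin d) (Fin m) ℤ) : AddSubmonoid (Fin d → ℤ) :=
  AddSubmonoid.closure (Set.range A.col)

/-- An integer vector, regarded as a real vector. -/
def toReal {d : ℕ} (u : Fin d → ℤ) : Fin d → ℝ := fun i => (u i : ℝ)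

/-- The cone `C = ℝ_{≥0} A ⊆ ℝ^d`. -/
def cone {d m : ℕ} (A : Matrix (Fin d) (Fin m) ℤ) : PointedCone ℝ (Fin d → ℝ) :=
  PointedCone.hull ℝ (Set.range fun j => toReal (A.col j))

/-- `ℕA` is normal: `C ∩ ℤ^d = ℕA`. -/
def IsNormal {d m : ℕ} (A : Matrix (Fin d) (Fin m) ℤ) : Prop :=
  ∀ u : Fin d → ℤ, toReal u ∈ cone A ↔ u ∈ semigroup A

/-- A facet of `C`, given by the index set `σ` of the columns of `A` lying on it: the face
`{x ∈ C | φ ⬝ᵥ x = 0}` cut out by a linear form `φ` that is nonnegative on `C`, where the face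
has dimension `d - 1`. (The face is the cone spanned by the columns that it contains, so
that facets and such index sets determine each other.) -/
def IsFacet {d m : ℕ} (A : Matrix (Fin d) (Fin m) ℤ) (σ : Finset (Fin m)) : Prop :=
  (∃ φ : Fin d → ℝ, (∀ x ∈ cone A, 0 ≤ φ ⬝ᵥ x) ∧ ∀ j, j ∈ σ ↔ φ ⬝ᵥ toReal (A.col j) = 0) ∧
    Module.finrank ℝ (Submodule.span ℝ ((fun j => toReal (A.col j)) '' (σ : Set (Fin m)))) + 1 = d

open Classical in
/-- The finite collection of facets of `C`. -/
def facets {d m : ℕ} (A : Matrix (Fin d) (Fin m) ℤ) : Finset (Finset (Fin m)) :=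
  Finset.univ.filter (IsFacet A)

/-- The conditions on the primitive integral support function `p ↦ F ⬝ᵥ p` of a facet `σ`:
it maps `ℤ^d` (which is `ℤA`) onto `ℤ`, is nonnegative on the columns of `A`, and vanishes
on those that lie in `σ`. -/
def IsPrimitiveSupport {d m : ℕ} (A : Matrix (Fin d) (Fin m) ℤ) (σ : Finset (Fin m))
    (F : Fin d → ℤ) : Prop :=
  (Function.Surjective fun u : Fin d → ℤ => F ⬝ᵥ u) ∧
    (∀ j, 0 ≤ F ⬝ᵥ A.col j) ∧ ∀ j ∈ σ, F ⬝ᵥ A.col j = 0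

/-- The coefficient vector of the primitive integral support function `F_σ` of a facet `σ`. -/
def supportFunction {d m : ℕ} (A : Matrix (Fin d) (Fin m) ℤ) (σ : Finset (Fin m)) :
    Fin d → ℤ :=
  Classical.epsilon (IsPrimitiveSupport A σ)

theorem dot_toReal {d : ℕ} (F u : Fin d → ℤ) : toReal F ⬝ᵥ toReal u = ((F ⬝ᵥ u : ℤ) : ℝ) := by
  simp [dotProduct, toReal]

theorem col_mem_cone {d m : ℕ} (A : Matrix (Fin d) (Fin m) ℤ) (j : Fin m) :
    toReal (A.col j) ∈ cone A :=
  Submodule.subset_span ⟨j, rfl⟩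

/-- If all columns lie in the hyperplane of `φ`, then `φ = 0`. -/
theorem eq_zero_of_forall_col {d m : ℕ} {A : Matrix (Fin d) (Fin m) ℤ}
    (hspan : AddSubgroup.closure (Set.range A.col) = ⊤) {φ : Fin d → ℝ}
    (h : ∀ j, φ ⬝ᵥ toReal (A.col j) = 0) : φ = 0 := by
  have key : ∀ u : Fin d → ℤ, φ ⬝ᵥ toReal u = 0 := by
    intro u
    have hu : u ∈ AddSubgroup.closure (Set.range A.col) := by rw [hspan]; trivial
    induction hu using AddSubgroup.closure_induction with
    | mem x hx => obtain ⟨j, rfl⟩ := hx; exact h j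
    | zero => simp [toReal, dotProduct]
    | add x y _ _ hx hy =>
      have : toReal (x + y) = toReal x + toReal y := by ext; simp [toReal]
      rw [this, dotProduct_add, hx, hy, add_zero]
    | neg x _ hx =>
      have : toReal (-x) = - toReal x := by ext; simp [toReal]
      rw [this, dotProduct_neg, hx, neg_zero]
  ext i
  have := key (Pi.single i 1)
  simpa [toReal, dotProduct, Pi.single_apply] using this

/-- Linear forms that vanish on a facet are proportional. -/
theorem exists_smul_of_facet {d m : ℕ} {A : Matrix (Fin d) (Fin m) ℤ} {σ : Finset (Fin m)}
    (hσ : Module.finrank ℝ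
      (Submodule.span ℝ ((fun j => toReal (A.col j)) '' (σ : Set (Fin m)))) + 1 = d)
    {φ ψ : Fin d → ℝ} (hφ : φ ≠ 0) (h : ∀ j ∈ σ, φ ⬝ᵥ toReal (A.col j) = 0)
    (h' : ∀ j ∈ σ, ψ ⬝ᵥ toReal (A.col j) = 0) : ∃ c : ℝ, ψ = c • φ := by
  set W := Submodule.span ℝ ((fun j => toReal (A.col j)) '' (σ : Set (Fin m))) with hW
  have e := Subspace.finrank_add_finrank_dualAnnihilator_eq W
  rw [Module.finrank_fin_fun] at e
  have e1 : Module.finrank ℝ W.dualAnnihilator = 1 := by omega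
  have mem : ∀ χ : Fin d → ℝ, (∀ j ∈ σ, χ ⬝ᵥ toReal (A.col j) = 0) →
      dotProductEquiv ℝ (Fin d) χ ∈ W.dualAnnihilator := by
    intro χ hχ
    rw [Submodule.mem_dualAnnihilator]
    intro w hw
    have : W ≤ LinearMap.ker (dotProductEquiv ℝ (Fin d) χ) := by
      rw [hW, Submodule.span_le]
      rintro _ ⟨j, hj, rfl⟩
      exact hχ j hj
    exact this hw
  have hne : (⟨_, mem φ h⟩ : W.dualAnnihilator) ≠ 0 := by
    intro h0
    apply hφ
    have := congrArg Subtype.val h0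
    simpa using this
  obtain ⟨c, hc⟩ := (finrank_eq_one_iff_of_nonzero' (K := ℝ)
    (⟨_, mem φ h⟩ : W.dualAnnihilator) hne).1 e1 ⟨_, mem ψ h'⟩
  refine ⟨c, (dotProductEquiv ℝ (Fin d)).injective ?_⟩
  have := congrArg Subtype.val hc
  simpa using this.symm

theorem exists_int_form {d m : ℕ} {A : Matrix (Fin d) (Fin m) ℤ} {σ : Finset (Fin m)}
    {φ : Fin d → ℝ} (hφ : φ ≠ 0) (h : ∀ j ∈ σ, φ ⬝ᵥ toReal (A.col j) = 0) :
    ∃ G : Fin d → ℤ, G ≠ 0 ∧ ∀ j ∈ σ, G ⬝ᵥ A.col j = 0 := by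
  obtain ⟨i, hi⟩ := Function.ne_iff.1 hφ
  obtain ⟨g, hg⟩ := Module.Projective.exists_dual_ne_zero ℚ hi
  obtain ⟨N, hN⟩ := IsLocalization.exist_integer_multiples_of_finset (nonZeroDivisors ℤ)
    (Finset.univ.image fun i => g (φ i))
  choose G hG using fun i => hN (g (φ i)) (Finset.mem_image_of_mem _ (Finset.mem_univ i))
  have hG' : ∀ i, (G i : ℚ) = (N : ℤ) * g (φ i) := by
    intro i; simpa using hG i
  have hN0 : ((N : ℤ) : ℚ) ≠ 0 := by
    exact_mod_cast nonZeroDivisors.ne_zero N.2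
  refine ⟨G, ?_, ?_⟩
  · intro h0
    have := hG' i
    rw [h0, Pi.zero_apply, Int.cast_zero] at this
    exact mul_ne_zero hN0 hg this.symm
  · intro j hj
    have h2 := congrArg g (h j hj)
    have : ((G ⬝ᵥ A.col j : ℤ) : ℚ) = (N : ℤ) * g (φ ⬝ᵥ toReal (A.col j)) := by
      simp only [dotProduct, map_sum, Finset.mul_sum, Int.cast_sum, Int.cast_mul, hG', toReal]
      refine Finset.sum_congr rfl fun i _ => ?_
      have : φ i * ((A.col j i : ℤ) : ℝ) = ((A.col j i : ℤ) : ℚ) • φ i := by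
        rw [Rat.smul_def]; push_cast; ring
      rw [this, map_smul, smul_eq_mul]; ring
    rw [h (j) hj, map_zero, mul_zero] at this
    exact_mod_cast this

/-- Every facet has exactly one primitive integral support function. -/
theorem existsUnique_isPrimitiveSupport {d m : ℕ} {A : Matrix (Fin d) (Fin m) ℤ}
    (hspan : AddSubgroup.closure (Set.range A.col) = ⊤) {σ : Finset (Fin m)}
    (hσ : IsFacet A σ) : ∃! F, IsPrimitiveSupport A σ F := by
  obtain ⟨⟨φ, hφ0, hφσ⟩, hd⟩ := hσ
  have hφ : φ ≠ 0 := by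
    rintro rfl
    have h1 : Submodule.span ℝ ((fun j => toReal (A.col j)) '' (σ : Set (Fin m))) = ⊤ := by
      by_contra hne
      obtain ⟨f, hf, hf'⟩ := Submodule.exists_le_ker_of_lt_top _ (lt_top_iff_ne_top.2 hne)
      apply hf
      have := eq_zero_of_forall_col hspan (φ := (dotProductEquiv ℝ (Fin d)).symm f) (by
        intro j
        have : f (toReal (A.col j)) = 0 := hf' (Submodule.subset_span ⟨j, by simp [hφσ], rfl⟩)
        rw [← this]
        conv_rhs => rw [← (dotProductEquiv ℝ (Fin d)).apply_symm_apply f]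
        rfl)
      simpa using this
    rw [h1, finrank_top, Module.finrank_fin_fun] at hd
    omega
  have hvan : ∀ j ∈ σ, φ ⬝ᵥ toReal (A.col j) = 0 := fun j hj => (hφσ j).1 hj
  obtain ⟨l, hl⟩ : ∃ l, φ ⬝ᵥ toReal (A.col l) ≠ 0 := by
    by_contra! hcon
    exact hφ (eq_zero_of_forall_col hspan hcon)
  have hl0 : 0 < φ ⬝ᵥ toReal (A.col l) := lt_of_le_of_ne (hφ0 _ (col_mem_cone A l)) hl.symm
  have cast0 : ∀ {G : Fin d → ℤ}, (∀ j ∈ σ, G ⬝ᵥ A.col j = 0) →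
      ∃ c : ℝ, toReal G = c • φ := by
    intro G hG
    refine exists_smul_of_facet hd hφ hvan fun j hj => ?_
    rw [dot_toReal, hG j hj, Int.cast_zero]
  -- a primitive form
  obtain ⟨G, hG0, hGσ⟩ := exists_int_form hφ hvan
  obtain ⟨i, hi⟩ := Function.ne_iff.1 hG0
  obtain ⟨H, hH, hH1⟩ := Finset.extract_gcd G (s := Finset.univ) ⟨i, Finset.mem_univ i⟩
  set D := Finset.univ.gcd G
  have hD : D ≠ 0 := by
    intro h0
    exact hi (by rw [hH i (Finset.mem_univ i), h0, zero_mul]; rfl)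
  have hHσ : ∀ j ∈ σ, H ⬝ᵥ A.col j = 0 := by
    intro j hj
    have : G = D • H := by ext i; simpa using hH i (Finset.mem_univ i)
    have h2 := hGσ j hj
    rw [this, smul_dotProduct, smul_eq_mul] at h2
    exact (mul_eq_zero.1 h2).resolve_left hD
  obtain ⟨v, hv⟩ : ∃ v : Fin d → ℤ, H ⬝ᵥ v = 1 := by
    obtain ⟨v, hv⟩ := Finset.gcd_eq_sum_mul (f := H) (s := Finset.univ)
    exact ⟨v, by rw [← hH1, hv]; rfl⟩
  obtain ⟨c, hc⟩ := cast0 hHσ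
  have pair : ∀ u, ((H ⬝ᵥ u : ℤ) : ℝ) = c * (φ ⬝ᵥ toReal u) := by
    intro u; rw [← dot_toReal, hc, smul_dotProduct, smul_eq_mul]
  have surj : ∀ {K w : Fin d → ℤ}, K ⬝ᵥ w = 1 →
      Function.Surjective fun u : Fin d → ℤ => K ⬝ᵥ u := fun {K w} h n =>
    ⟨n • w, by
      change K ⬝ᵥ (n • w) = n
      rw [dotProduct_smul, h, smul_eq_mul, mul_one]⟩
  have hex : ∃ F, IsPrimitiveSupport A σ F := by
    rcases le_total 0 c with h | h
    · refine ⟨H, surj hv, fun j => ?_, hHσ⟩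
      have := mul_nonneg h (hφ0 _ (col_mem_cone A j))
      rw [← pair] at this
      exact_mod_cast this
    · refine ⟨-H, surj (w := -v) (by simpa using hv), fun j => ?_, fun j hj => by
        rw [neg_dotProduct, hHσ j hj, neg_zero]⟩
      have := mul_nonpos_of_nonpos_of_nonneg h (hφ0 _ (col_mem_cone A j))
      rw [← pair] at this
      have : H ⬝ᵥ A.col j ≤ 0 := by exact_mod_cast this
      rw [neg_dotProduct]; omega
  obtain ⟨F, hF⟩ := hex
  refine ⟨F, hF, fun F' hF' => ?_⟩
  obtain ⟨a, ha⟩ := cast0 hF.2.2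
  obtain ⟨a', ha'⟩ := cast0 hF'.2.2
  have pr : ∀ u, ((F ⬝ᵥ u : ℤ) : ℝ) = a * (φ ⬝ᵥ toReal u) := by
    intro u; rw [← dot_toReal, ha, smul_dotProduct, smul_eq_mul]
  have pr' : ∀ u, ((F' ⬝ᵥ u : ℤ) : ℝ) = a' * (φ ⬝ᵥ toReal u) := by
    intro u; rw [← dot_toReal, ha', smul_dotProduct, smul_eq_mul]
  obtain ⟨w, hw⟩ := hF.1 1
  obtain ⟨w', hw'⟩ := hF'.1 1
  simp only at hw hw'
  have e1 := pr w
  have e1' := pr' w'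
  rw [hw, Int.cast_one] at e1
  rw [hw', Int.cast_one] at e1'
  have ha0 : 0 < a := by
    have h1 : (0 : ℝ) ≤ a * (φ ⬝ᵥ toReal (A.col l)) := by
      rw [← pr]; exact_mod_cast hF.2.1 l
    refine lt_of_le_of_ne (nonneg_of_mul_nonneg_left h1 hl0) ?_
    rintro rfl; simp at e1
  have ha0' : 0 < a' := by
    have h1 : (0 : ℝ) ≤ a' * (φ ⬝ᵥ toReal (A.col l)) := by
      rw [← pr']; exact_mod_cast hF'.2.1 l
    refine lt_of_le_of_ne (nonneg_of_mul_nonneg_left h1 hl0) ?_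
    rintro rfl; simp at e1'
  have q1 : ((F' ⬝ᵥ w : ℤ) : ℝ) * a = a' := by
    rw [pr']; linear_combination (-a') * e1
  have q2 : ((F ⬝ᵥ w' : ℤ) : ℝ) * a' = a := by
    rw [pr]; linear_combination (-a) * e1'
  have hz : (0 : ℝ) < ((F' ⬝ᵥ w : ℤ) : ℝ) := by
    by_contra! hcon; nlinarith
  have hz' : (0 : ℝ) < ((F ⬝ᵥ w' : ℤ) : ℝ) := by
    by_contra! hcon; nlinarith
  have hge : (1 : ℝ) ≤ ((F' ⬝ᵥ w : ℤ) : ℝ) := by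
    have : 0 < F' ⬝ᵥ w := by exact_mod_cast hz
    exact_mod_cast this
  have hge' : (1 : ℝ) ≤ ((F ⬝ᵥ w' : ℤ) : ℝ) := by
    have : 0 < F ⬝ᵥ w' := by exact_mod_cast hz'
    exact_mod_cast this
  have haa : a = a' := by
    apply le_antisymm <;> nlinarith
  ext i
  have := congrFun (ha'.trans (haa ▸ ha.symm)) i
  simpa [toReal] using this

/-- The defining properties of `F_σ`. -/
theorem isPrimitiveSupport_supportFunction {d m : ℕ} {A : Matrix (Fin d) (Fin m) ℤ}
    (hspan : AddSubgroup.closure (Set.range A.col) = ⊤) {σ : Finset (Fin m)}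
    (hσ : σ ∈ facets A) : IsPrimitiveSupport A σ (supportFunction A σ) := by
  classical
  exact Classical.epsilon_spec
    (existsUnique_isPrimitiveSupport hspan (Finset.mem_filter.1 hσ).2).exists

/-! ### Differential operators -/

/-- Grothendieck's `k`-linear differential operators of order at most `n` on a commutative
`k`-algebra `R`. -/
def IsDiffOp (k : Type*) [Field k] {R : Type*} [CommRing R] [Algebra k R] :
    ℕ → Module.End k R → Prop
  | 0, P => ∃ r : R, P = LinearMap.mulLeft k r
  | n + 1, P => ∀ r : R, IsDiffOp k n (P * LinearMap.mulLeft k r - LinearMap.mulLeft k r * P)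

/-- Laurent polynomials `S[y_1^{±1}, …, y_d^{±1}]`; the monomial `y^v` is `single v 1`. -/
abbrev Laurent (S : Type*) [CommRing S] (d : ℕ) : Type _ := AddMonoidAlgebra S (Fin d → ℤ)

/-- The semigroup ring `k[ℕA]`, as a subring of `k[y_1^{±1}, …, y_d^{±1}]`. -/
def toricRing (k : Type*) [Field k] {d m : ℕ} (A : Matrix (Fin d) (Fin m) ℤ) :
    Subalgebra k (Laurent k d) :=
  (AddMonoidAlgebra.mapDomainAlgHom k k (semigroup A).subtype).range

/-- The Euler operator `θ_j = y_j ∂_{y_j}` on `S[y^{±1}] · y^e`, where `e ∈ S^d` is a formal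
exponent: `θ_j (h y^v · y^e) = (v_j + e_j) h y^v · y^e`. For `e = 0` it is the usual operator
on Laurent polynomials. -/
def euler {S : Type*} [CommRing S] {d : ℕ} (e : Fin d → S) (j : Fin d) :
    Laurent S d →ₗ[S] Laurent S d :=
  (AddMonoidAlgebra.coeffLinearEquiv S).symm.toLinearMap ∘ₗ
    Finsupp.lsum S (fun v => ((v j : S) + e j) • Finsupp.lsingle v) ∘ₗ
      (AddMonoidAlgebra.coeffLinearEquiv S).toLinearMap

theorem euler_single {S : Type*} [CommRing S] {d : ℕ} (e : Fin d → S) (j : Fin d)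
    (v : Fin d → ℤ) (h : S) :
    euler e j (AddMonoidAlgebra.single v h) =
      AddMonoidAlgebra.single v (((v j : S) + e j) * h) := by
  apply AddMonoidAlgebra.coeff_injective
  simp [euler]

/-! ### The module `k[y^{±1}, s_1, …, s_r] ∏ (y^{β_i})^{s_i}` -/

/-- The polynomial ring `k[s_1, …, s_r]`. -/
abbrev SPoly (k : Type*) [Field k] (r : ℕ) : Type _ := MvPolynomial (Fin r) k

/-- `ℓ_β(s) = s_1 β_1 + ⋯ + s_r β_r`, a vector of length `d` over `k[s_1, …, s_r]`. -/
def ell (k : Type*) [Field k] {d r : ℕ} (β : Fin r → Fin d → ℤ) : Fin d → SPoly k r :=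
  fun j => ∑ i, MvPolynomial.X i * (β i j : SPoly k r)

/-- `ℓ_β(c) = c_1 β_1 + ⋯ + c_r β_r` for `c ∈ ℤ^r`. -/
def ellInt {d r : ℕ} (β : Fin r → Fin d → ℤ) (c : Fin r → ℤ) : Fin d → ℤ :=
  ∑ i, c i • β i

/-- The free rank one module `k[y^{±1}, s_1, …, s_r] ∏ f_i^{s_i}` for `f_i = y^{β_i}`. The
element `u` stands for `u ∏ f_i^{s_i}`, where `∏ f_i^{s_i} = y^{ℓ_β(s)}`. It contains
`k[ℕA][∏ f_i⁻¹, s_1, …, s_r] ∏ f_i^{s_i}` as a submodule for all the operators below. -/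
abbrev FsModule (k : Type*) [Field k] (d r : ℕ) : Type _ := Laurent (SPoly k r) d

/-- The ring `k[y^{±1}]⟨∂_{y_1}, …, ∂_{y_d}⟩` of differential operators on Laurent polynomials,
together with its action on `k[y^{±1}, s] y^{ℓ_β(s)}` by formal differentiation, in the form
of the graph of this action: the algebra of pairs (operator on `k[y^{±1}]`, operator on
`k[y^{±1}, s] y^{ℓ_β(s)}`) that is generated by the Laurent monomials and the Euler operators. -/
def weylGraph (k : Type*) [Field k] {d r : ℕ} (β : Fin r → Fin d → ℤ) :
    Subalgebra k (Module.End k (Laurent k d) × Module.End k (FsModule k d r)) :=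
  Algebra.adjoin k
    ((Set.range fun w : Fin d → ℤ =>
        (LinearMap.mulLeft k (AddMonoidAlgebra.single w 1 : Laurent k d),
          LinearMap.mulLeft k (AddMonoidAlgebra.single w 1 : FsModule k d r))) ∪
      Set.range fun j : Fin d =>
        (euler (0 : Fin d → k) j, (euler (ell k β) j).restrictScalars k))

/-- `T` is the action on `k[y^{±1}, s] ∏ f_i^{s_i}` of the operator `P` on `k[ℕA]`: the operator
`P` is the restriction to `k[ℕA]` of an operator in `k[y^{±1}]⟨∂_y⟩`, and `T` is the action of
the latter. (A differential operator on `k[ℕA]` extends uniquely to Laurent polynomials, as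
these are a localization of `k[ℕA]`.) -/
def ActsAs {k : Type*} [Field k] {d m r : ℕ} (A : Matrix (Fin d) (Fin m) ℤ)
    (β : Fin r → Fin d → ℤ) (P : Module.End k (toricRing k A))
    (T : Module.End k (FsModule k d r)) : Prop :=
  ∃ δ : Module.End k (Laurent k d), (δ, T) ∈ weylGraph k β ∧
    ∀ g : toricRing k A, δ (g : Laurent k d) = (P g : Laurent k d)

/-- The operators on `k[y^{±1}, s] ∏ f_i^{s_i}` given by the ring `D_A = D_k(k[ℕA])`. -/
def toricOperators (k : Type*) [Field k] {d m r : ℕ} (A : Matrix (Fin d) (Fin m) ℤ)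
    (β : Fin r → Fin d → ℤ) : Set (Module.End k (FsModule k d r)) :=
  {T | ∃ P : Module.End k (toricRing k A), (∃ n, IsDiffOp k n P) ∧ ActsAs A β P T}

/-- The substitution `s_i ↦ s_i + n`, `s_j ↦ s_j` for `j ≠ i`. -/
def shift (k : Type*) [Field k] {r : ℕ} (i : Fin r) (n : ℤ) : SPoly k r →ₐ[k] SPoly k r :=
  MvPolynomial.aeval fun j =>
    MvPolynomial.X j + if j = i then (n : SPoly k r) else 0

/-- The operator `t_i`, `n = 1`, and its inverse, `n = -1`:
`u(s) ∏ f_j^{s_j} ↦ u(s_1, …, s_i + n, …, s_r) f_i^n ∏ f_j^{s_j}`, for `f_i = y^{β_i}`. -/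
def tOp (k : Type*) [Field k] {d r : ℕ} (β : Fin r → Fin d → ℤ) (i : Fin r) (n : ℤ) :
    Module.End k (FsModule k d r) :=
  LinearMap.mulLeft k (AddMonoidAlgebra.single (n • β i) 1 : FsModule k d r) *
    (AddMonoidAlgebra.mapAlgHom (Fin d → ℤ) (shift k i n)).toLinearMap

/-- Multiplication by `s_i`. -/
def sOp (k : Type*) [Field k] (d : ℕ) {r : ℕ} (i : Fin r) : Module.End k (FsModule k d r) :=
  Algebra.lsmul k k (FsModule k d r) (MvPolynomial.X i : SPoly k r)

/-- The operator `s_{ij} = s_i t_i⁻¹ t_j`. -/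
def sijOp (k : Type*) [Field k] {d r : ℕ} (β : Fin r → Fin d → ℤ) (i j : Fin r) :
    Module.End k (FsModule k d r) :=
  sOp k d i * tOp k β i (-1) * tOp k β j 1

/-- The operators on `k[y^{±1}, s] ∏ f_i^{s_i}` given by `D_A[s_{ij} | i, j ∈ {1, …, r}]`. -/
def bsOperators (k : Type*) [Field k] {d m r : ℕ} (A : Matrix (Fin d) (Fin m) ℤ)
    (β : Fin r → Fin d → ℤ) : Subalgebra k (Module.End k (FsModule k d r)) :=
  Algebra.adjoin k
    (toricOperators k A β ∪ Set.range fun p : Fin r × Fin r => sijOp k β p.1 p.2)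

/-! ### Bernstein–Sato polynomials -/

/-- `b(s_1 + ⋯ + s_r)`. -/
def evalSum {k : Type*} [Field k] (r : ℕ) (b : Polynomial k) : SPoly k r :=
  Polynomial.aeval (∑ i, MvPolynomial.X i) b

/-- The functional equation `b(s_1 + ⋯ + s_r) ∏ f_i^{s_i} = ∑ P_l t_l ∏ f_i^{s_i}` for some
`P_1, …, P_r ∈ D_A[s_{ij}]`. -/
def FunctionalEquation {k : Type*} [Field k] {d m r : ℕ} (A : Matrix (Fin d) (Fin m) ℤ)
    (β : Fin r → Fin d → ℤ) (b : Polynomial k) : Prop :=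
  ∃ P : Fin r → Module.End k (FsModule k d r), (∀ l, P l ∈ bsOperators k A β) ∧
    evalSum r b • (1 : FsModule k d r) = ∑ l, P l (tOp k β l 1 1)

/-- `b` is the monic polynomial of smallest degree with the property `Q`. -/
def IsMonicOfLeastDegree {k : Type*} [Field k] (Q : Polynomial k → Prop) (b : Polynomial k) :
    Prop :=
  b.Monic ∧ Q b ∧ ∀ p : Polynomial k, p.Monic → Q p → b.natDegree ≤ p.natDegree

/-- `b` is the Bernstein–Sato polynomial of `(y^{β_1}, …, y^{β_r})` in `k[ℕA]`. -/
def IsBernsteinSato {k : Type*} [Field k] {d m r : ℕ} (A : Matrix (Fin d) (Fin m) ℤ)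
    (β : Fin r → Fin d → ℤ) (b : Polynomial k) : Prop :=
  IsMonicOfLeastDegree (FunctionalEquation A β) b

/-! ### The combinatorial ideal -/

/-- `binom(p, n) = p (p - 1) ⋯ (p - n + 1) / n!`. -/
def binom {k : Type*} [Field k] {r : ℕ} (p : SPoly k r) (n : ℕ) : SPoly k r :=
  MvPolynomial.C ((n.factorial : k)⁻¹) * ∏ j ∈ Finset.range n, (p - (j : SPoly k r))

/-- `F_σ(w)` for a vector `w` over `k[s_1, …, s_r]`. -/
def supportEval {k : Type*} [Field k] {d m r : ℕ} (A : Matrix (Fin d) (Fin m) ℤ)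
    (σ : Finset (Fin m)) (w : Fin d → SPoly k r) : SPoly k r :=
  (fun j => (supportFunction A σ j : SPoly k r)) ⬝ᵥ w

/-- The polynomial `g_c`: the product of the `binom(s_i, -c_i)` over the `i` with `c_i < 0`, times
the product of the `binom(F_σ(ℓ_β(s) + ℓ_β(c)), F_σ(ℓ_β(c)))` over the facets `σ` with
`F_σ(ℓ_β(c)) > 0`. -/
def generator (k : Type*) [Field k] {d m r : ℕ} (A : Matrix (Fin d) (Fin m) ℤ)
    (β : Fin r → Fin d → ℤ) (c : Fin r → ℤ) : SPoly k r :=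
  (∏ i with c i < 0, binom (MvPolynomial.X i) (-c i).toNat) *
    ∏ σ ∈ facets A with 0 < supportFunction A σ ⬝ᵥ ellInt β c,
      binom (supportEval A σ (ell k β + fun j => (ellInt β c j : SPoly k r)))
        (supportFunction A σ ⬝ᵥ ellInt β c).toNat

/-- The ideal of `k[s_1, …, s_r]` generated by the `g_c` for `c ∈ ℤ^r` with coordinate sum `1`. -/
def combinatorialIdeal (k : Type*) [Field k] {d m r : ℕ} (A : Matrix (Fin d) (Fin m) ℤ)
    (β : Fin r → Fin d → ℤ) : Ideal (SPoly k r) :=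
  Ideal.span {g | ∃ c : Fin r → ℤ, ∑ i, c i = 1 ∧ g = generator k A β c}

end ToricBS

end

/-!
A differential operator on `k[ℕA]` is the restriction of an operator on Laurent polynomials, and
these are the finite sums of homogeneous operators `y^v p_v(θ)` with `p_v` a polynomial in the Euler
operators (`exists_finsupp_of_mem_weylGraph`). The sum preserves `k[ℕA]` if and only if every `p_v`
vanishes at the points `u ∈ ℕA` with `u + v ∉ ℕA`. As `ℕA` is normal, it is cut out by the facet
inequalities `F_σ ≥ 0` (`mem_semigroup_iff`); the points in question therefore form a union of
slices `F_σ = j`, `0 ≤ j < -F_σ(v)`, of `ℕA`, which are Zariski dense in their hyperplanes, and the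
condition is that `p_v` is divisible by `∏_σ ∏_{0 ≤ j < -F_σ(v)} (F_σ - j)` (`boundary_dvd`).

All products that occur have the form `rise L a b = ∏_{a < x ≤ b} (L + x)`. Up to factorials,
`g_c` is the value at `w = 0` of
`∏_i rise s_i c_i 0 * ∏_σ rise F_σ(ℓ_β(s)) F_σ(w) F_σ(ℓ_β(c))`.
Let `I_w` be the ideal generated by these products for the `c` with coordinate sum `1`.
The subspace of all `∑ y^w h_w` with `h_w ∈ I_w` contains the elements `t_l ∏ f_i^{s_i}` and is
stable under the operators: `y^v p_v(θ)` replaces the interval `(F_σ(w), F_σ(ℓ_β(c))]` by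
`(F_σ(w + v), F_σ(ℓ_β(c))]`, and `s_{ij}` replaces `c` by `c + e_j - e_i` and `w` by
`w + β_j - β_i`. So the right-hand side of a functional equation lies in `I_0`, the combinatorial
ideal. Conversely, operators `s_{ij}` lead from some `t_l ∏ f_i^{s_i}` to
`∏_i rise s_i c_i 0 · y^{ℓ_β(c)}` (`falling_mem_bsModule`), and the operator of degree
`-ℓ_β(c)` whose coefficient is the boundary polynomial takes this element to a
constant multiple of `g_c`. Since `s_{ii}` is multiplication by `s_i`, the whole ideal is reached. Thus a polynomial satisfies a
functional equation exactly if it lies in the ideal, and the two notions of a monic polynomial of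
least degree agree.
-/

noncomputable section

namespace ToricBS

/-! ### Facet inequalities of the cone -/

/-- Farkas' lemma for finitely generated cones, by eliminating one generator at a time. No
topology is needed, so that closedness of the cone does not have to be proved first. -/
theorem exists_nonneg_sum_of_forall_dual {ι : Type*} {d : ℕ} (s : Finset ι) (a : ι → Fin d → ℝ)
    (x : Fin d → ℝ)
    (h : ∀ φ : Fin d → ℝ, (∀ j ∈ s, 0 ≤ φ ⬝ᵥ a j) → 0 ≤ φ ⬝ᵥ x) :
    ∃ c : ι → ℝ, (∀ j ∈ s, 0 ≤ c j) ∧ x = ∑ j ∈ s, c j • a j := by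
  classical
  induction s using Finset.induction_on generalizing a x with
  | empty =>
    refine ⟨0, by simp, ?_⟩
    have h1 := h (-x) (by simp)
    rw [neg_dotProduct] at h1
    have h2 : x ⬝ᵥ x = 0 :=
      le_antisymm (by linarith) (Finset.sum_nonneg fun i _ => mul_self_nonneg _)
    simpa using dotProduct_self_eq_zero.1 h2
  | insert l s hl ih =>
    by_cases hs : ∀ φ : Fin d → ℝ, (∀ j ∈ s, 0 ≤ φ ⬝ᵥ a j) → 0 ≤ φ ⬝ᵥ x
    · obtain ⟨c, hc, rfl⟩ := ih a x hs
      refine ⟨fun j => if j = l then 0 else c j, ?_, ?_⟩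
      · intro j hj
        by_cases hjl : j = l
        · simp [hjl]
        · simpa [hjl] using hc j ((Finset.mem_insert.1 hj).resolve_left hjl)
      · rw [Finset.sum_insert hl]
        beta_reduce
        rw [if_pos rfl, zero_smul, zero_add]
        refine Finset.sum_congr rfl fun j hj => ?_
        rw [if_neg (by rintro rfl; exact hl hj)]
    · push Not at hs
      obtain ⟨φ, hφ, hx⟩ := hs
      have hal : φ ⬝ᵥ a l < 0 := by
        by_contra! hcon
        refine absurd (h φ fun j hj => ?_) (not_le.2 hx)
        rcases Finset.mem_insert.1 hj with rfl | hj
        exacts [hcon, hφ j hj]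
      set t := φ ⬝ᵥ a l with ht
      -- project along `a l` onto the hyperplane of `φ`
      obtain ⟨c, hc, hcx⟩ := ih (fun j => a j - (φ ⬝ᵥ a j / t) • a l)
        (x - (φ ⬝ᵥ x / t) • a l) (by
          intro ψ hψ
          have key : ∀ y, (ψ - (ψ ⬝ᵥ a l / t) • φ) ⬝ᵥ y =
              ψ ⬝ᵥ (y - (φ ⬝ᵥ y / t) • a l) := by
            intro y
            rw [sub_dotProduct, smul_dotProduct, dotProduct_sub, dotProduct_smul]
            simp only [smul_eq_mul]; ring
          rw [← key]
          refine h _ fun j hj => ?_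
          rw [key]
          rcases Finset.mem_insert.1 hj with rfl | hj
          · rw [← ht, div_self hal.ne, one_smul, sub_self, dotProduct_zero]
          · exact hψ j hj)
      refine ⟨fun j => if j = l then φ ⬝ᵥ x / t - ∑ i ∈ s, c i * (φ ⬝ᵥ a i / t) else c j,
        ?_, ?_⟩
      · intro j hj
        beta_reduce
        by_cases hjl : j = l
        · rw [if_pos hjl]
          have h1 : 0 ≤ φ ⬝ᵥ x / t := div_nonneg_of_nonpos hx.le hal.le
          have h2 : ∑ i ∈ s, c i * (φ ⬝ᵥ a i / t) ≤ 0 := Finset.sum_nonpos fun i hi =>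
            mul_nonpos_of_nonneg_of_nonpos (hc i hi)
              (div_nonpos_of_nonneg_of_nonpos (hφ i hi) hal.le)
          linarith
        · rw [if_neg hjl]
          exact hc j ((Finset.mem_insert.1 hj).resolve_left hjl)
      · rw [Finset.sum_insert hl]
        beta_reduce
        rw [if_pos rfl]
        have e1 : ∑ j ∈ s, (if j = l then φ ⬝ᵥ x / t - ∑ i ∈ s, c i * (φ ⬝ᵥ a i / t)
            else c j) • a j = ∑ j ∈ s, c j • a j := by
          refine Finset.sum_congr rfl fun j hj => ?_
          rw [if_neg (by rintro rfl; exact hl hj)]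
        rw [e1]
        simp only [smul_sub, smul_smul, Finset.sum_sub_distrib, ← Finset.sum_smul] at hcx
        rw [sub_smul]
        refine (sub_eq_iff_eq_add.1 hcx).trans ?_
        abel

variable {d m : ℕ} {A : Matrix (Fin d) (Fin m) ℤ}

theorem exists_dual_neg_of_notMem_cone {x : Fin d → ℝ} (hx : x ∉ cone A) :
    ∃ φ : Fin d → ℝ, (∀ j, 0 ≤ φ ⬝ᵥ toReal (A.col j)) ∧ φ ⬝ᵥ x < 0 := by
  by_contra! hcon
  obtain ⟨c, hc, rfl⟩ := exists_nonneg_sum_of_forall_dual Finset.univ (fun j => toReal (A.col j)) x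
    fun φ hφ => hcon φ fun j => hφ j (Finset.mem_univ j)
  refine hx (Submodule.sum_mem _ fun j hj => ?_)
  exact Submodule.smul_mem _ (⟨c j, hc j hj⟩ : {t : ℝ // 0 ≤ t}) (col_mem_cone A j)

theorem dual_nonneg_of_mem_cone {φ x : Fin d → ℝ} (h : ∀ j, 0 ≤ φ ⬝ᵥ toReal (A.col j))
    (hx : x ∈ cone A) : 0 ≤ φ ⬝ᵥ x := by
  induction hx using Submodule.span_induction with
  | mem y hy => obtain ⟨j, rfl⟩ := hy; exact h j
  | zero => simp
  | add y z _ _ hy hz => rw [dotProduct_add]; exact add_nonneg hy hz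
  | smul a y _ hy =>
    have : a • y = (a : ℝ) • y := rfl
    rw [this, dotProduct_smul]
    exact mul_nonneg a.2 hy

/-- A point outside the cone violates a facet inequality: among the forms separating the point
from the cone, one that vanishes on the largest number of columns defines a facet, since
otherwise it can be moved, keeping its value at the point, until it vanishes on one column
more. -/
theorem exists_facet_neg (hspan : AddSubgroup.closure (Set.range A.col) = ⊤)
    {x : Fin d → ℝ} (hx : x ∉ cone A) :
    ∃ (σ : Finset (Fin m)) (φ : Fin d → ℝ), IsFacet A σ ∧
      (∀ j, 0 ≤ φ ⬝ᵥ toReal (A.col j)) ∧ (∀ j, j ∈ σ ↔ φ ⬝ᵥ toReal (A.col j) = 0) ∧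
      φ ⬝ᵥ x < 0 := by
  classical
  let Z : (Fin d → ℝ) → Finset (Fin m) :=
    fun φ => Finset.univ.filter fun j => φ ⬝ᵥ toReal (A.col j) = 0
  have hZ : ∀ φ j, j ∈ Z φ ↔ φ ⬝ᵥ toReal (A.col j) = 0 := by simp [Z]
  let S : Set (Fin d → ℝ) := {φ | (∀ j, 0 ≤ φ ⬝ᵥ toReal (A.col j)) ∧ φ ⬝ᵥ x < 0}
  have hS : S.Nonempty := exists_dual_neg_of_notMem_cone hx
  obtain ⟨φ, ⟨hφ0, hφx⟩, hmax⟩ : ∃ φ ∈ S, ∀ ψ ∈ S, (Z ψ).card ≤ (Z φ).card := by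
    have hfin : ((fun φ => (Z φ).card) '' S).Finite := by
      refine (Set.finite_Iic m).subset ?_
      rintro _ ⟨φ, _, rfl⟩
      simpa using Finset.card_le_univ (Z φ)
    obtain ⟨_, ⟨⟨φ, hφ, rfl⟩, h⟩⟩ :=
      hfin.exists_maximal (hS.image _)
    refine ⟨φ, hφ, fun ψ hψ => ?_⟩
    by_contra! hlt
    exact absurd (h ⟨ψ, hψ, rfl⟩ hlt.le) (not_le.2 hlt)
  refine ⟨Z φ, φ, ⟨⟨φ, fun y => dual_nonneg_of_mem_cone hφ0, hZ φ⟩, ?_⟩, hφ0, hZ φ, hφx⟩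
  set W := Submodule.span ℝ ((fun j => toReal (A.col j)) '' (Z φ : Set (Fin m))) with hW
  have hφW : dotProductEquiv ℝ (Fin d) φ ∈ W.dualAnnihilator := by
    rw [Submodule.mem_dualAnnihilator]
    intro w hw
    have : W ≤ LinearMap.ker (dotProductEquiv ℝ (Fin d) φ) := by
      rw [hW, Submodule.span_le]
      rintro _ ⟨j, hj, rfl⟩
      exact (hZ φ j).1 hj
    exact this hw
  have hφ_ne : φ ≠ 0 := by rintro rfl; simp at hφx
  have e := Subspace.finrank_add_finrank_dualAnnihilator_eq W
  rw [Module.finrank_fin_fun] at e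
  suffices Module.finrank ℝ W.dualAnnihilator = 1 by omega
  refine finrank_eq_one (⟨_, hφW⟩ : W.dualAnnihilator) (by simpa using hφ_ne) ?_
  rintro ⟨f, hf⟩
  obtain ⟨ψ, rfl⟩ := (dotProductEquiv ℝ (Fin d)).surjective f
  have hψ : ∀ j ∈ Z φ, ψ ⬝ᵥ toReal (A.col j) = 0 := fun j hj =>
    (Submodule.mem_dualAnnihilator _).1 hf _ (Submodule.subset_span ⟨j, hj, rfl⟩)
  -- it is enough that the combination of `φ` and `ψ` that vanishes at `x` is zero
  suffices h : ∀ χ : Fin d → ℝ, (∀ j ∈ Z φ, χ ⬝ᵥ toReal (A.col j) = 0) → χ ⬝ᵥ x = 0 →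
      ∀ j, 0 ≤ χ ⬝ᵥ toReal (A.col j) by
    refine ⟨ψ ⬝ᵥ x / φ ⬝ᵥ x, Subtype.ext ?_⟩
    have hχ : ψ - (ψ ⬝ᵥ x / φ ⬝ᵥ x) • φ = 0 := by
      have h0 : ∀ j ∈ Z φ, (ψ - (ψ ⬝ᵥ x / φ ⬝ᵥ x) • φ) ⬝ᵥ toReal (A.col j) = 0 := by
        intro j hj
        rw [sub_dotProduct, smul_dotProduct, hψ j hj, (hZ φ j).1 hj, smul_zero, sub_zero]
      have hx0 : (ψ - (ψ ⬝ᵥ x / φ ⬝ᵥ x) • φ) ⬝ᵥ x = 0 := by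
        rw [sub_dotProduct, smul_dotProduct, smul_eq_mul, div_mul_cancel₀ _ hφx.ne, sub_self]
      refine eq_zero_of_forall_col hspan fun j => le_antisymm ?_ (h _ h0 hx0 j)
      have := h (-(ψ - (ψ ⬝ᵥ x / φ ⬝ᵥ x) • φ))
        (fun j hj => by rw [neg_dotProduct, h0 j hj, neg_zero])
        (by rw [neg_dotProduct, hx0, neg_zero]) j
      rw [neg_dotProduct] at this
      linarith
    simp only [SetLike.mk_smul_mk]
    rw [← map_smul, ← sub_eq_zero.1 hχ]
  intro χ hχ hχx
  by_contra! hcon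
  obtain ⟨l, hl⟩ := hcon
  obtain ⟨i, hi, himin⟩ := Finset.exists_min_image
    (Finset.univ.filter fun j => χ ⬝ᵥ toReal (A.col j) < 0)
    (fun j => φ ⬝ᵥ toReal (A.col j) / -(χ ⬝ᵥ toReal (A.col j))) ⟨l, by simpa using hl⟩
  simp only [Finset.mem_filter, Finset.mem_univ, true_and] at hi himin
  set t := φ ⬝ᵥ toReal (A.col i) / -(χ ⬝ᵥ toReal (A.col i)) with ht
  have hval : ∀ y, (φ + t • χ) ⬝ᵥ y = φ ⬝ᵥ y + t * (χ ⬝ᵥ y) := by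
    intro y; rw [add_dotProduct, smul_dotProduct, smul_eq_mul]
  have ht0 : 0 ≤ t := div_nonneg (hφ0 i) (by linarith)
  have hmem : φ + t • χ ∈ S := by
    refine ⟨fun j => ?_, ?_⟩
    · rw [hval]
      rcases lt_or_ge (χ ⬝ᵥ toReal (A.col j)) 0 with hj | hj
      · have := (le_div_iff₀ (by linarith)).1 (himin j hj)
        linarith
      · exact add_nonneg (hφ0 j) (mul_nonneg ht0 hj)
    · rw [hval, hχx, mul_zero, add_zero]; exact hφx
  refine absurd (hmax _ hmem) (not_le.2 (Finset.card_lt_card ?_))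
  rw [Finset.ssubset_iff_of_subset]
  · refine ⟨i, ?_, fun hi' => ?_⟩
    · rw [hZ, hval, ht]
      field_simp [hi.ne]
      ring
    · rw [hχ i hi'] at hi; exact lt_irrefl _ hi
  · intro j hj
    rw [hZ, hval, hχ j hj, (hZ φ j).1 hj, mul_zero, add_zero]

theorem isFacet_of_mem {σ : Finset (Fin m)} (hσ : σ ∈ facets A) : IsFacet A σ := by
  classical
  exact (Finset.mem_filter.1 hσ).2

theorem supportFunction_ne_zero (hspan : AddSubgroup.closure (Set.range A.col) = ⊤)
    {σ : Finset (Fin m)} (hσ : σ ∈ facets A) : supportFunction A σ ≠ 0 := by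
  intro h
  obtain ⟨u, hu⟩ := (isPrimitiveSupport_supportFunction hspan hσ).1 1
  simp [h] at hu

theorem exists_pos_of_ne_zero (hspan : AddSubgroup.closure (Set.range A.col) = ⊤)
    {F : Fin d → ℤ} (hF : F ≠ 0) (h0 : ∀ j, 0 ≤ F ⬝ᵥ A.col j) : ∃ l, 0 < F ⬝ᵥ A.col l := by
  by_contra! hcon
  apply hF
  have := eq_zero_of_forall_col hspan (φ := toReal F) (fun j => by
    rw [dot_toReal, le_antisymm (hcon j) (h0 j), Int.cast_zero])
  ext i
  simpa [toReal] using congrFun this i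

/-- A form that is nonnegative on the cone and vanishes on a facet is a nonnegative multiple of
the support function of that facet. -/
theorem exists_nonneg_smul_supportFunction
    (hspan : AddSubgroup.closure (Set.range A.col) = ⊤) {σ : Finset (Fin m)}
    (hσ : σ ∈ facets A) {φ : Fin d → ℝ} (h0 : ∀ j, 0 ≤ φ ⬝ᵥ toReal (A.col j))
    (h : ∀ j ∈ σ, φ ⬝ᵥ toReal (A.col j) = 0) :
    ∃ c : ℝ, 0 ≤ c ∧ φ = c • toReal (supportFunction A σ) := by
  have hF := isPrimitiveSupport_supportFunction hspan hσ
  have hne := supportFunction_ne_zero hspan hσ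
  obtain ⟨c, hc⟩ := exists_smul_of_facet (isFacet_of_mem hσ).2
    (φ := toReal (supportFunction A σ))
    (by
      intro h; apply hne; ext i; simpa [toReal] using congrFun h i)
    (fun j hj => by rw [dot_toReal, hF.2.2 j hj, Int.cast_zero]) h
  refine ⟨c, ?_, hc⟩
  obtain ⟨l, hl⟩ := exists_pos_of_ne_zero hspan hne hF.2.1
  have := h0 l
  rw [hc, smul_dotProduct, dot_toReal, smul_eq_mul] at this
  exact nonneg_of_mul_nonneg_left this (by exact_mod_cast hl)

/-- The facet description of a normal semigroup: `ℕA` consists of the integer points at which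
all primitive integral support functions are nonnegative. -/
theorem mem_semigroup_iff (hspan : AddSubgroup.closure (Set.range A.col) = ⊤)
    (hnormal : IsNormal A) {u : Fin d → ℤ} :
    u ∈ semigroup A ↔ ∀ σ ∈ facets A, 0 ≤ supportFunction A σ ⬝ᵥ u := by
  constructor
  · intro hu σ hσ
    induction hu using AddSubmonoid.closure_induction with
    | mem x hx =>
      obtain ⟨j, rfl⟩ := hx
      exact (isPrimitiveSupport_supportFunction hspan hσ).2.1 j
    | zero => simp
    | add x y _ _ hx hy => rw [dotProduct_add]; exact add_nonneg hx hy
  · intro h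
    rw [← hnormal]
    by_contra hu
    obtain ⟨σ, φ, hσ, hφ0, hφσ, hφu⟩ := exists_facet_neg hspan hu
    have hσ' : σ ∈ facets A := by
      classical
      exact Finset.mem_filter.2 ⟨Finset.mem_univ _, hσ⟩
    obtain ⟨c, hc, rfl⟩ :=
      exists_nonneg_smul_supportFunction hspan hσ' hφ0 fun j hj => (hφσ j).1 hj
    rw [smul_dotProduct, dot_toReal, smul_eq_mul] at hφu
    have h1 : (0 : ℝ) ≤ ((supportFunction A σ ⬝ᵥ u : ℤ) : ℝ) := by exact_mod_cast h σ hσ'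
    nlinarith [mul_nonneg hc h1]

/-- The relative interior of a facet contains a lattice point: there, all the other support
functions are positive. -/
theorem exists_facet_interior (hspan : AddSubgroup.closure (Set.range A.col) = ⊤)
    {σ : Finset (Fin m)} (hσ : σ ∈ facets A) :
    ∃ e : Fin d → ℤ, supportFunction A σ ⬝ᵥ e = 0 ∧
      ∀ τ ∈ facets A, τ ≠ σ → 0 < supportFunction A τ ⬝ᵥ e := by
  have hF := isPrimitiveSupport_supportFunction hspan hσ
  refine ⟨∑ j ∈ σ, A.col j, ?_, fun τ hτ hne => ?_⟩
  · rw [dotProduct_sum]; exact Finset.sum_eq_zero hF.2.2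
  have hG := isPrimitiveSupport_supportFunction hspan hτ
  rw [dotProduct_sum]
  refine lt_of_le_of_ne (Finset.sum_nonneg fun j _ => hG.2.1 j) fun h0 => hne ?_
  have hz := (Finset.sum_eq_zero_iff_of_nonneg fun j _ => hG.2.1 j).1 h0.symm
  -- a support function vanishing on `σ` has the same zero set as the one of `σ`
  have hzero : ∀ ρ ∈ facets A, ∀ j, j ∈ ρ ↔ supportFunction A ρ ⬝ᵥ A.col j = 0 := by
    intro ρ hρ j
    refine ⟨fun hj => (isPrimitiveSupport_supportFunction hspan hρ).2.2 j hj, fun hj => ?_⟩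
    obtain ⟨φ, hφ0, hφ⟩ := (isFacet_of_mem hρ).1
    obtain ⟨c, -, rfl⟩ := exists_nonneg_smul_supportFunction hspan hρ
      (fun i => hφ0 _ (col_mem_cone A i)) fun i hi => (hφ i).1 hi
    rw [hφ, smul_dotProduct, dot_toReal, hj, Int.cast_zero, smul_zero]
  obtain ⟨c, -, hc⟩ := exists_nonneg_smul_supportFunction hspan hσ
    (φ := toReal (supportFunction A τ))
    (fun j => by rw [dot_toReal]; exact_mod_cast hG.2.1 j)
    (fun j hj => by rw [dot_toReal, hz j hj, Int.cast_zero])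
  have hc0 : c ≠ 0 := by
    rintro rfl
    apply supportFunction_ne_zero hspan hτ
    ext i
    simpa [toReal] using congrFun hc i
  ext j
  rw [hzero τ hτ, hzero σ hσ]
  have := congrArg (· ⬝ᵥ toReal (A.col j)) hc
  simp only [smul_dotProduct, dot_toReal, smul_eq_mul] at this
  constructor
  · intro h
    rw [h, Int.cast_zero] at this
    exact_mod_cast (mul_eq_zero.1 this.symm).resolve_left hc0
  · intro h
    rw [h, Int.cast_zero, mul_zero] at this
    exact_mod_cast this

/-! ### Products of consecutive shifts -/

/-- The product `(L + a + 1) (L + a + 2) ⋯ (L + b)` of the shifts of `L` by the integers in the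
interval `(a, b]`; it is `1` if `b ≤ a`. Both kinds of factors in the combinatorial ideal, and the
polynomial coefficients of differential operators, have this form. -/
def rise {R : Type*} [CommRing R] (L : R) (a b : ℤ) : R := ∏ x ∈ Finset.Ioc a b, (L + (x : R))

section rise

variable {R S : Type*} [CommRing R] [CommRing S]

theorem rise_of_le (L : R) {a b : ℤ} (h : b ≤ a) : rise L a b = 1 := by
  rw [rise, Finset.Ioc_eq_empty_of_le h, Finset.prod_empty]

theorem map_rise {F : Type*} [FunLike F R S] [RingHomClass F R S] (f : F) (L : R) (a b : ℤ) :
    f (rise L a b) = rise (f L) a b := by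
  simp [rise, map_prod]

theorem rise_add_intCast (L : R) (n a b : ℤ) : rise (L + n) a b = rise L (a + n) (b + n) := by
  refine Finset.prod_nbij' (· + n) (· - n) ?_ ?_ ?_ ?_ ?_
  · intro x hx; simp only [Finset.mem_Ioc] at hx ⊢; omega
  · intro x hx; simp only [Finset.mem_Ioc] at hx ⊢; omega
  · intro x _; simp
  · intro x _; simp
  · intro x _; push_cast; ring

/-- `(a, c]` is covered by `(a, b]` and `(b, c]`, whatever the order of `a`, `b` and `c`. -/
theorem rise_dvd_mul (L : R) (a b c : ℤ) : rise L a c ∣ rise L a b * rise L b c := by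
  unfold rise
  rw [← Finset.prod_union]
  · refine Finset.prod_dvd_prod_of_subset _ _ _ fun x hx => ?_
    simp only [Finset.mem_Ioc, Finset.mem_union] at hx ⊢
    omega
  · rw [Finset.disjoint_left]
    intro x hx hx'
    simp only [Finset.mem_Ioc] at hx hx'
    omega

theorem rise_mul_rise (L : R) {a b c : ℤ} (hab : a ≤ b) (hbc : b ≤ c) :
    rise L a b * rise L b c = rise L a c := by
  unfold rise
  rw [← Finset.prod_union]
  · congr 1
    ext x
    simp only [Finset.mem_Ioc, Finset.mem_union]
    omega
  · rw [Finset.disjoint_left]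
    intro x hx hx'
    simp only [Finset.mem_Ioc] at hx hx'
    omega

theorem rise_pred_self (L : R) (a : ℤ) : rise L (a - 1) a = L + a := by
  have : Finset.Ioc (a - 1) a = {a} := by
    ext x; simp only [Finset.mem_Ioc, Finset.mem_singleton]; omega
  rw [rise, this, Finset.prod_singleton]

theorem prod_range_sub_eq_rise (L : R) (n : ℕ) :
    ∏ j ∈ Finset.range n, (L - (j : R)) = rise L (-n) 0 := by
  refine Finset.prod_nbij' (fun j => -(j : ℤ)) (fun x => (-x).toNat) ?_ ?_ ?_ ?_ ?_
  · intro x hx; simp only [Finset.mem_Ioc, Finset.mem_range] at hx ⊢; omega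
  · intro x hx; simp only [Finset.mem_Ioc, Finset.mem_range] at hx ⊢; omega
  · intro x _; simp
  · intro x hx; simp only [Finset.mem_Ioc] at hx; omega
  · intro x _; push_cast; ring

end rise

/-! ### Polynomials vanishing on the boundary of the semigroup -/

section linear

variable (k : Type*) [Field k] {d : ℕ}

/-- The linear form with integer coefficients `F` as a polynomial. -/
def linForm (F : Fin d → ℤ) : MvPolynomial (Fin d) k :=
  (fun j => (F j : MvPolynomial (Fin d) k)) ⬝ᵥ MvPolynomial.X

theorem map_linForm {S : Type*} [CommRing S] [Algebra k S] (f : MvPolynomial (Fin d) k →ₐ[k] S)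
    (F : Fin d → ℤ) :
    f (linForm k F) = (fun j => (F j : S)) ⬝ᵥ fun j => f (MvPolynomial.X j) := by
  simp [linForm, dotProduct, map_sum]

theorem aeval_linForm_int (F u : Fin d → ℤ) :
    MvPolynomial.aeval (fun j => (u j : k)) (linForm k F) = ((F ⬝ᵥ u : ℤ) : k) := by
  rw [map_linForm]; simp [dotProduct]

/-- The projection to the hyperplane `F + x = 0` along `v`, acting on polynomials. -/
def project (F v : Fin d → ℤ) (x : ℤ) : MvPolynomial (Fin d) k →ₐ[k] MvPolynomial (Fin d) k :=
  MvPolynomial.aeval fun i => MvPolynomial.X i -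
    (v i : MvPolynomial (Fin d) k) * (linForm k F + (x : MvPolynomial (Fin d) k))

variable {k}

theorem project_self {F v : Fin d → ℤ} (hv : F ⬝ᵥ v = 1) (x : ℤ) :
    project k F v x (linForm k F + x) = 0 := by
  have hv' : ∑ j, (F j : MvPolynomial (Fin d) k) * (v j : MvPolynomial (Fin d) k) = 1 := by
    have := congrArg (Int.cast : ℤ → MvPolynomial (Fin d) k) hv
    simpa [dotProduct] using this
  rw [map_add, map_linForm, map_intCast]
  simp only [project, MvPolynomial.aeval_X, dotProduct, mul_sub, Finset.sum_sub_distrib,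
    ← mul_assoc, ← Finset.sum_mul, hv', one_mul]
  simp [linForm, dotProduct]

theorem dvd_sub_project (F v : Fin d → ℤ) (x : ℤ) (p : MvPolynomial (Fin d) k) :
    linForm k F + x ∣ p - project k F v x p := by
  refine Ideal.mem_span_singleton.1 (Ideal.Quotient.eq.1 ?_)
  have : (Ideal.Quotient.mkₐ k (Ideal.span {linForm k F + (x : MvPolynomial (Fin d) k)})) =
      (Ideal.Quotient.mkₐ k _).comp (project k F v x) := by
    ext i
    simp only [AlgHom.comp_apply, project, MvPolynomial.aeval_X]
    refine Ideal.Quotient.eq.2 (Ideal.mem_span_singleton.2 ?_)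
    rw [sub_sub_cancel]
    exact Dvd.intro_left _ rfl
  exact DFunLike.congr_fun this p

theorem dvd_iff_project_eq_zero {F v : Fin d → ℤ} (hv : F ⬝ᵥ v = 1) (x : ℤ)
    (p : MvPolynomial (Fin d) k) : linForm k F + x ∣ p ↔ project k F v x p = 0 := by
  constructor
  · rintro ⟨q, rfl⟩
    rw [map_mul, project_self hv, zero_mul]
  · intro h
    simpa [h] using dvd_sub_project F v x p

theorem prime_linForm_add {F v : Fin d → ℤ} (hv : F ⬝ᵥ v = 1) (x : ℤ) :
    Prime (linForm k F + (x : MvPolynomial (Fin d) k)) := by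
  refine ⟨fun h => ?_, fun h => ?_, fun a b hab => ?_⟩
  · have h1 := congrArg (MvPolynomial.aeval fun j => ((v j : ℤ) : k)) h
    have h0 := congrArg (MvPolynomial.aeval fun j => (((0 : Fin d → ℤ) j : ℤ) : k)) h
    rw [map_add, aeval_linForm_int, map_intCast, map_zero] at h0 h1
    rw [dotProduct_zero, Int.cast_zero, zero_add] at h0
    rw [hv, h0] at h1
    simp at h1
  · have := h.map (project k F v x)
    rw [project_self hv] at this
    exact not_isUnit_zero this
  · simp only [dvd_iff_project_eq_zero hv, map_mul, mul_eq_zero] at hab ⊢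
    exact hab

/-- A polynomial vanishing at the integer points of the hyperplane `F + x = 0` is divisible by
`F + x`. -/
theorem linForm_add_dvd_of_forall_int [CharZero k] {F v : Fin d → ℤ} (hv : F ⬝ᵥ v = 1) (x : ℤ)
    {p : MvPolynomial (Fin d) k}
    (h : ∀ u : Fin d → ℤ, F ⬝ᵥ u = -x → MvPolynomial.aeval (fun j => (u j : k)) p = 0) :
    linForm k F + (x : MvPolynomial (Fin d) k) ∣ p := by
  rw [dvd_iff_project_eq_zero hv]
  refine MvPolynomial.funext_set (fun _ => Set.range (Int.cast : ℤ → k))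
    (fun _ => Set.infinite_range_of_injective Int.cast_injective) fun y hy => ?_
  choose u hu using fun i => hy i (Set.mem_univ i)
  obtain rfl : (fun i => (u i : k)) = y := funext hu
  have key := h (u - (F ⬝ᵥ u + x) • v) (by
    rw [dotProduct_sub, dotProduct_smul, hv]; simp)
  rw [map_zero, ← MvPolynomial.coe_aeval_eq_eval, ← key]
  change ((MvPolynomial.aeval fun i => (u i : k)).comp (project k F v x)) p = _
  congr 1
  ext i
  simp only [AlgHom.comp_apply, project, MvPolynomial.aeval_X, map_sub, map_mul, map_add,
    map_intCast, aeval_linForm_int]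
  simp [mul_comm]

end linear

section boundary

variable {k : Type*} [Field k] {d m : ℕ} {A : Matrix (Fin d) (Fin m) ℤ}

/-- A polynomial that vanishes on the points of the semigroup with `F_σ = j`, where `j ≥ 0`,
vanishes at all integer points with `F_σ = j`: moving far enough along the facet, one enters the
semigroup, and a polynomial in one variable with infinitely many zeros is zero. -/
theorem aeval_eq_zero_of_forall_semigroup [CharZero k]
    (hspan : AddSubgroup.closure (Set.range A.col) = ⊤)
    (hnormal : IsNormal A) {σ : Finset (Fin m)} (hσ : σ ∈ facets A) {j : ℤ} (hj : 0 ≤ j)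
    {p : MvPolynomial (Fin d) k}
    (h : ∀ u ∈ semigroup A, supportFunction A σ ⬝ᵥ u = j →
      MvPolynomial.aeval (fun i => (u i : k)) p = 0)
    {u : Fin d → ℤ} (hu : supportFunction A σ ⬝ᵥ u = j) :
    MvPolynomial.aeval (fun i => (u i : k)) p = 0 := by
  obtain ⟨e, he0, he⟩ := exists_facet_interior hspan hσ
  let q : Polynomial k :=
    MvPolynomial.aeval (fun i => Polynomial.C (u i : k) + Polynomial.X * Polynomial.C (e i : k)) p
  have hq : ∀ n : ℕ, q.eval (n : k) =
      MvPolynomial.aeval (fun i => ((u + n • e) i : k)) p := by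
    intro n
    rw [← Polynomial.coe_aeval_eq_eval]
    change (((Polynomial.aeval (n : k)).restrictScalars k).comp (MvPolynomial.aeval _)) p = _
    congr 1
    ext i
    simp
  have hq0 : q = 0 := by
    refine Polynomial.eq_zero_of_infinite_isRoot _ ?_
    let N := ∑ τ ∈ facets A, (supportFunction A τ ⬝ᵥ u).natAbs
    refine ((Set.Ici_infinite N).image (Nat.cast_injective (R := k)).injOn).mono ?_
    rintro _ ⟨n, hn, rfl⟩
    change q.eval (n : k) = 0
    rw [hq]
    refine h _ ((mem_semigroup_iff hspan hnormal).2 fun τ hτ => ?_) ?_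
    · rw [dotProduct_add, dotProduct_smul]
      rcases eq_or_ne τ σ with rfl | hne
      · rw [he0, hu]; simpa using hj
      · have h1 : (supportFunction A τ ⬝ᵥ u).natAbs ≤ N :=
          Finset.single_le_sum (f := fun τ => (supportFunction A τ ⬝ᵥ u).natAbs)
            (fun _ _ => Nat.zero_le _) hτ
        have h2 : N ≤ n := hn
        have h3 := he τ hτ hne
        have h4 : (n : ℤ) * 1 ≤ n * (supportFunction A τ ⬝ᵥ e) :=
          mul_le_mul_of_nonneg_left h3 (Int.natCast_nonneg n)
        rw [nsmul_eq_mul]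
        omega
    · rw [dotProduct_add, dotProduct_smul, he0, hu]; simp
  have := hq 0
  rw [hq0] at this
  simpa using this.symm

/-- The polynomial `∏_σ ∏_{0 ≤ j < -F_σ(v)} (F_σ - j)`. By `boundary_dvd` it generates the ideal of
polynomials vanishing at the points of `ℕA` that leave `ℕA` when translated by `v`. -/
def boundary (k : Type*) [Field k] {d m : ℕ} (A : Matrix (Fin d) (Fin m) ℤ) (v : Fin d → ℤ) :
    MvPolynomial (Fin d) k :=
  ∏ σ ∈ facets A, rise (linForm k (supportFunction A σ)) (supportFunction A σ ⬝ᵥ v) 0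

theorem aeval_boundary_eq_zero (hspan : AddSubgroup.closure (Set.range A.col) = ⊤)
    (hnormal : IsNormal A) {u v : Fin d → ℤ} (hu : u ∈ semigroup A) (huv : u + v ∉ semigroup A) :
    MvPolynomial.aeval (fun i => (u i : k)) (boundary k A v) = 0 := by
  rw [mem_semigroup_iff hspan hnormal] at hu huv
  push Not at huv
  obtain ⟨σ, hσ, hneg⟩ := huv
  have := hu σ hσ
  rw [dotProduct_add] at hneg
  rw [boundary, map_prod]
  refine Finset.prod_eq_zero hσ ?_
  rw [rise, map_prod]
  refine Finset.prod_eq_zero (i := -(supportFunction A σ ⬝ᵥ u))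
    (Finset.mem_Ioc.2 ⟨by omega, by omega⟩) ?_
  rw [map_add, aeval_linForm_int, map_intCast]
  simp

theorem boundary_dvd [CharZero k] (hspan : AddSubgroup.closure (Set.range A.col) = ⊤)
    (hnormal : IsNormal A) {v : Fin d → ℤ} {p : MvPolynomial (Fin d) k}
    (h : ∀ u ∈ semigroup A, u + v ∉ semigroup A →
      MvPolynomial.aeval (fun i => (u i : k)) p = 0) : boundary k A v ∣ p := by
  have hprim : ∀ σ ∈ facets A, ∃ w, supportFunction A σ ⬝ᵥ w = 1 := fun σ hσ =>
    (isPrimitiveSupport_supportFunction hspan hσ).1 1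
  unfold boundary rise
  rw [Finset.prod_sigma']
  refine Finset.prod_dvd_of_isRelPrime ?_ ?_
  · rintro ⟨σ, x⟩ hσx ⟨τ, y⟩ hτy hne
    simp only [Finset.coe_sigma, Set.mem_sigma_iff, Finset.mem_coe] at hσx hτy
    obtain ⟨hσ, -⟩ := hσx
    obtain ⟨hτ, -⟩ := hτy
    obtain ⟨w, hw⟩ := hprim σ hσ
    rw [Function.onFun, (prime_linForm_add hw x).irreducible.isRelPrime_iff_not_dvd]
    rintro ⟨q, hq⟩
    -- on the hyperplane `F_σ = -x` the form `F_τ + y` has to vanish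
    have key : ∀ u, supportFunction A σ ⬝ᵥ u = -x → supportFunction A τ ⬝ᵥ u = -y := by
      intro u hu
      have := congrArg (MvPolynomial.aeval fun i => (u i : k)) hq
      rw [map_mul, map_add, map_add, aeval_linForm_int, aeval_linForm_int, hu, map_intCast,
        map_intCast, Int.cast_neg, neg_add_cancel, zero_mul] at this
      have h2 : supportFunction A τ ⬝ᵥ u + y = 0 := by exact_mod_cast this
      omega
    have h1 := key (-x • w) (by rw [dotProduct_smul, hw, smul_eq_mul, mul_one])
    rcases eq_or_ne τ σ with rfl | hτσ
    · apply hne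
      rw [dotProduct_smul, hw, smul_eq_mul, mul_one] at h1
      rw [neg_inj.1 h1]
    · obtain ⟨e, he0, he⟩ := exists_facet_interior hspan hσ
      have h2 := key (-x • w + e) (by
        rw [dotProduct_add, dotProduct_smul, hw, he0, smul_eq_mul, mul_one, add_zero])
      rw [dotProduct_add, h1] at h2
      have := he τ hτ hτσ
      omega
  · rintro ⟨σ, x⟩ hσx
    simp only [Finset.mem_sigma, Finset.mem_Ioc] at hσx
    obtain ⟨hσ, hx, hx0⟩ := hσx
    obtain ⟨w, hw⟩ := hprim σ hσ
    refine linForm_add_dvd_of_forall_int hw x fun u hu =>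
      aeval_eq_zero_of_forall_semigroup hspan hnormal hσ (by omega) (fun u hu hux => ?_) hu
    refine h u hu fun hmem => ?_
    have := (mem_semigroup_iff hspan hnormal).1 hmem σ hσ
    rw [dotProduct_add] at this
    omega

end boundary

/-! ### Homogeneous differential operators on Laurent polynomials -/

section monOp

variable {k : Type*} [Field k] {S : Type*} [CommRing S] [Algebra k S] {d : ℕ}

theorem laurent_end_ext {f g : Module.End k (Laurent S d)}
    (h : ∀ u a, f (AddMonoidAlgebra.single u a) = g (AddMonoidAlgebra.single u a)) : f = g := by
  refine LinearMap.ext fun x => ?_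
  induction x using AddMonoidAlgebra.induction_linear with
  | zero => simp
  | add x y hx hy => rw [map_add, map_add, hx, hy]
  | single u a => exact h u a

/-- The homogeneous operator `y^v p(θ)` on `S[y^{±1}] y^e`, where `p(θ)` is a polynomial in the
Euler operators: `a y^u y^e ↦ p(u + e) a y^{u + v} y^e`. -/
def monOp (e : Fin d → S) (v : Fin d → ℤ) (p : MvPolynomial (Fin d) k) :
    Module.End k (Laurent S d) :=
  (AddMonoidAlgebra.coeffLinearEquiv k).symm.toLinearMap ∘ₗ
    Finsupp.lsum k (fun u : Fin d → ℤ => Finsupp.lsingle (u + v) ∘ₗ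
      LinearMap.mulLeft k (MvPolynomial.aeval (fun j => (u j : S) + e j) p)) ∘ₗ
      (AddMonoidAlgebra.coeffLinearEquiv k).toLinearMap

theorem monOp_single (e : Fin d → S) (v : Fin d → ℤ) (p : MvPolynomial (Fin d) k)
    (u : Fin d → ℤ) (a : S) :
    monOp e v p (AddMonoidAlgebra.single u a) = AddMonoidAlgebra.single (u + v)
      (MvPolynomial.aeval (fun j => (u j : S) + e j) p * a) := by
  apply AddMonoidAlgebra.coeff_injective
  simp [monOp]

theorem monOp_add (e : Fin d → S) (v : Fin d → ℤ) (p q : MvPolynomial (Fin d) k) :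
    monOp e v (p + q) = monOp e v p + monOp e v q :=
  laurent_end_ext fun u a => by
    rw [LinearMap.add_apply, monOp_single, monOp_single, monOp_single, map_add, add_mul,
      AddMonoidAlgebra.single_add]

theorem monOp_smul (e : Fin d → S) (v : Fin d → ℤ) (c : k) (p : MvPolynomial (Fin d) k) :
    monOp e v (c • p) = c • monOp e v p :=
  laurent_end_ext fun u a => by
    rw [LinearMap.smul_apply, monOp_single, monOp_single, map_smul, smul_mul_assoc,
      AddMonoidAlgebra.smul_single]

theorem monOp_mul (e : Fin d → S) (v w : Fin d → ℤ) (p q : MvPolynomial (Fin d) k) :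
    monOp e v p * monOp e w q = monOp e (w + v)
      (MvPolynomial.aeval (fun j => MvPolynomial.X j + (w j : MvPolynomial (Fin d) k)) p * q) :=
  laurent_end_ext fun u a => by
    rw [Module.End.mul_apply, monOp_single, monOp_single, monOp_single, map_mul, mul_assoc,
      add_assoc]
    congr 2
    rw [← AlgHom.comp_apply]
    congr 1
    ext j
    simp only [AlgHom.comp_apply, MvPolynomial.aeval_X, map_add, map_intCast, Pi.add_apply]
    push_cast
    ring

theorem mulLeft_single_eq_monOp (e : Fin d → S) (w : Fin d → ℤ) :
    LinearMap.mulLeft k (AddMonoidAlgebra.single w 1 : Laurent S d) = monOp e w 1 :=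
  laurent_end_ext fun u a => by
    rw [monOp_single, LinearMap.mulLeft_apply, AddMonoidAlgebra.single_mul_single, map_one,
      add_comm]

theorem euler_eq_monOp (e : Fin d → S) (j : Fin d) :
    (euler e j).restrictScalars k = monOp e 0 (MvPolynomial.X j) :=
  laurent_end_ext fun u a => by
    rw [monOp_single, LinearMap.restrictScalars_apply, euler_single, MvPolynomial.aeval_X,
      add_zero]

theorem algebraMap_eq_monOp (e : Fin d → S) (c : k) :
    algebraMap k (Module.End k (Laurent S d)) c = monOp e 0 (MvPolynomial.C c) :=
  laurent_end_ext fun u a => by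
    rw [monOp_single, MvPolynomial.aeval_C, add_zero, Module.algebraMap_end_apply,
      AddMonoidAlgebra.smul_single, Algebra.smul_def]

end monOp

section weylGraph

variable {k : Type*} [Field k] {d r : ℕ} {β : Fin r → Fin d → ℤ}

/-- The operator `y^v p(θ)` on Laurent polynomials, paired with its formal action on
`k[y^{±1}, s] y^{ℓ_β(s)}`; it is linear in `p`. -/
def monPair (β : Fin r → Fin d → ℤ) (v : Fin d → ℤ) :
    MvPolynomial (Fin d) k →ₗ[k]
      Module.End k (Laurent k d) × Module.End k (FsModule k d r) where
  toFun p := (monOp 0 v p, monOp (ell k β) v p)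
  map_add' p q := by rw [monOp_add, monOp_add]; rfl
  map_smul' c p := by rw [monOp_smul, monOp_smul]; rfl

theorem monPair_mem_weylGraph (v : Fin d → ℤ) (p : MvPolynomial (Fin d) k) :
    monPair β v p ∈ weylGraph k β := by
  have hmul : ∀ w q, monPair β w (1 : MvPolynomial (Fin d) k) * monPair β 0 q =
      monPair β w q := by
    intro w q
    refine Prod.ext ?_ ?_ <;>
      · change monOp _ _ _ * monOp _ _ _ = monOp _ _ _
        rw [monOp_mul, zero_add, map_one, one_mul]
  rw [← hmul]
  refine mul_mem (Algebra.subset_adjoin (Or.inl ⟨v, ?_⟩)) ?_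
  · exact Prod.ext (mulLeft_single_eq_monOp _ _) (mulLeft_single_eq_monOp _ _)
  induction p using MvPolynomial.induction_on with
  | C a =>
    have : monPair β 0 (MvPolynomial.C a) = algebraMap k _ a :=
      Prod.ext (algebraMap_eq_monOp _ _).symm (algebraMap_eq_monOp _ _).symm
    rw [this]
    exact algebraMap_mem _ _
  | add p q hp hq => rw [map_add]; exact add_mem hp hq
  | mul_X p j hp =>
    have : monPair β 0 (p * MvPolynomial.X j) = monPair β 0 p *
        (euler (0 : Fin d → k) j, (euler (ell k β) j).restrictScalars k) := by
      have h1 : ∀ {S : Type _} [CommRing S] [Algebra k S] (e : Fin d → S),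
          monOp e 0 (p * MvPolynomial.X j) =
            monOp e 0 p * (euler e j).restrictScalars k := by
        intro S _ _ e
        rw [euler_eq_monOp, monOp_mul, add_zero]
        congr 2
        simp
      exact Prod.ext (h1 _) (h1 _)
    rw [this]
    exact mul_mem hp (Algebra.subset_adjoin (Or.inr ⟨j, rfl⟩))

/-- Every differential operator on Laurent polynomials is a finite sum of homogeneous operators
`y^v p_v(θ)`. -/
theorem exists_finsupp_of_mem_weylGraph
    {x : Module.End k (Laurent k d) × Module.End k (FsModule k d r)} (hx : x ∈ weylGraph k β) :
    ∃ p : (Fin d → ℤ) →₀ MvPolynomial (Fin d) k, p.sum (fun v q => monPair β v q) = x := by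
  let M := Submodule.span k
    (Set.range fun z : (Fin d → ℤ) × MvPolynomial (Fin d) k => monPair β z.1 z.2)
  have hmem : ∀ v p, monPair β v p ∈ M := fun v p => Submodule.subset_span ⟨(v, p), rfl⟩
  have hM : x ∈ M := by
    induction hx using Algebra.adjoin_induction with
    | mem x hx =>
      rcases hx with ⟨w, rfl⟩ | ⟨j, rfl⟩
      · convert hmem w 1 using 1
        exact Prod.ext (mulLeft_single_eq_monOp _ _) (mulLeft_single_eq_monOp _ _)
      · convert hmem 0 (MvPolynomial.X j) using 1
        exact Prod.ext (euler_eq_monOp _ _) (euler_eq_monOp _ _)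
    | algebraMap c =>
      convert hmem 0 (MvPolynomial.C c) using 1
      exact Prod.ext (algebraMap_eq_monOp _ _) (algebraMap_eq_monOp _ _)
    | add x y _ _ hx hy => exact add_mem hx hy
    | mul x y _ _ hx hy =>
      have hle : M * M ≤ M := by
        rw [Submodule.span_mul_span, Submodule.span_le]
        rintro _ ⟨_, ⟨⟨v, p⟩, rfl⟩, _, ⟨⟨w, q⟩, rfl⟩, rfl⟩
        have e : monPair β v p * monPair β w q = monPair β (w + v) (MvPolynomial.aeval
            (fun j => MvPolynomial.X j + (w j : MvPolynomial (Fin d) k)) p * q) :=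
          Prod.ext (monOp_mul _ _ _ _ _) (monOp_mul _ _ _ _ _)
        change monPair β v p * monPair β w q ∈ M
        rw [e]
        exact hmem _ _
      exact hle (Submodule.mul_mem_mul hx hy)
  have hle : M ≤ LinearMap.range (Finsupp.lsum k (monPair (k := k) β)) := by
    rw [Submodule.span_le]
    rintro _ ⟨⟨v, p⟩, rfl⟩
    exact ⟨Finsupp.single v p, by simp⟩
  obtain ⟨p, rfl⟩ := hle hM
  exact ⟨p, rfl⟩

end weylGraph

/-! ### Differential operators in the sense of Grothendieck -/

section IsDiffOp

variable {k : Type*} [Field k] {R : Type*} [CommRing R] [Algebra k R]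

theorem IsDiffOp.zero (n : ℕ) : IsDiffOp k n (0 : Module.End k R) := by
  induction n with
  | zero => exact ⟨0, by ext; simp⟩
  | succ n ih => intro r; simpa using ih

theorem mulLeft_commutator (a r : R) :
    LinearMap.mulLeft k a * LinearMap.mulLeft k r - LinearMap.mulLeft k r * LinearMap.mulLeft k a
      = 0 := by
  ext x
  simp [mul_left_comm]

theorem IsDiffOp.succ {n : ℕ} {P : Module.End k R} (h : IsDiffOp k n P) :
    IsDiffOp k (n + 1) P := by
  induction n generalizing P with
  | zero =>
    obtain ⟨a, rfl⟩ := h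
    intro r
    rw [mulLeft_commutator]
    exact IsDiffOp.zero 0
  | succ n ih => exact fun r => ih (h r)

theorem IsDiffOp.mono {n n' : ℕ} (hn : n ≤ n') {P : Module.End k R} (h : IsDiffOp k n P) :
    IsDiffOp k n' P := by
  induction hn with
  | refl => exact h
  | step _ ih => exact ih.succ

theorem IsDiffOp.add {n : ℕ} {P Q : Module.End k R} (hP : IsDiffOp k n P)
    (hQ : IsDiffOp k n Q) : IsDiffOp k n (P + Q) := by
  induction n generalizing P Q with
  | zero =>
    obtain ⟨a, rfl⟩ := hP
    obtain ⟨b, rfl⟩ := hQ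
    exact ⟨a + b, by ext; simp [add_mul]⟩
  | succ n ih =>
    intro r
    have : (P + Q) * LinearMap.mulLeft k r - LinearMap.mulLeft k r * (P + Q) =
        (P * LinearMap.mulLeft k r - LinearMap.mulLeft k r * P) +
          (Q * LinearMap.mulLeft k r - LinearMap.mulLeft k r * Q) := by
      rw [add_mul, mul_add]; abel
    rw [this]
    exact ih (hP r) (hQ r)

theorem IsDiffOp.mul {n n' : ℕ} {P Q : Module.End k R} (hP : IsDiffOp k n P)
    (hQ : IsDiffOp k n' Q) : IsDiffOp k (n + n') (P * Q) := by
  have key : ∀ (P Q : Module.End k R) (r : R),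
      P * Q * LinearMap.mulLeft k r - LinearMap.mulLeft k r * (P * Q) =
        P * (Q * LinearMap.mulLeft k r - LinearMap.mulLeft k r * Q) +
          (P * LinearMap.mulLeft k r - LinearMap.mulLeft k r * P) * Q := by
    intro P Q r
    simp only [mul_sub, sub_mul, mul_assoc]
    abel
  induction n generalizing P Q n' with
  | zero =>
    obtain ⟨a, rfl⟩ := hP
    induction n' generalizing Q with
    | zero =>
      obtain ⟨b, rfl⟩ := hQ
      exact ⟨a * b, by ext; simp⟩
    | succ n' ih =>
      intro r
      rw [key, mulLeft_commutator, zero_mul, add_zero]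
      exact ih (hQ r)
  | succ n ih =>
    induction n' generalizing Q with
    | zero =>
      obtain ⟨b, rfl⟩ := hQ
      intro r
      rw [key, mulLeft_commutator, mul_zero, zero_add]
      exact ih (hP r) (n' := 0) ⟨b, rfl⟩
    | succ n' ih' =>
      intro r
      rw [key]
      refine IsDiffOp.add (ih' (hQ r)) ?_
      have := ih (hP r) hQ
      rwa [show n + (n' + 1) = n + 1 + n' by omega] at this

/-- The restriction of a differential operator to a subalgebra that it preserves is a differential
operator of the same order. -/
theorem IsDiffOp.restrict {B : Subalgebra k R} {n : ℕ} {δ : Module.End k R}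
    (hδ : IsDiffOp k n δ) {P : Module.End k B} (h : ∀ g : B, δ (g : R) = (P g : R)) :
    IsDiffOp k n P := by
  induction n generalizing δ P with
  | zero =>
    obtain ⟨a, rfl⟩ := hδ
    have ha : a = (P 1 : R) := by rw [← h]; simp
    refine ⟨P 1, LinearMap.ext fun g => Subtype.ext ?_⟩
    rw [← h]
    simp [← ha]
  | succ n ih =>
    intro r
    refine ih (hδ r) fun g => ?_
    simp [h, ← h (r * g)]

theorem isDiffOp_of_mem_weylGraph {d r : ℕ} {β : Fin r → Fin d → ℤ}
    {x : Module.End k (Laurent k d) × Module.End k (FsModule k d r)} (hx : x ∈ weylGraph k β) :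
    ∃ n, IsDiffOp k n x.1 := by
  induction hx using Algebra.adjoin_induction with
  | mem x hx =>
    rcases hx with ⟨w, rfl⟩ | ⟨j, rfl⟩
    · exact ⟨0, _, rfl⟩
    · refine ⟨1, fun g => ⟨euler 0 j g, ?_⟩⟩
      -- the Euler operator is a derivation
      have leibniz : ∀ g h : Laurent k d,
          euler (0 : Fin d → k) j (g * h) = euler 0 j g * h + g * euler 0 j h := by
        intro g h
        induction g using AddMonoidAlgebra.induction_linear with
        | zero => simp
        | add x y hx hy => rw [add_mul, map_add, hx, hy, map_add]; ring
        | single u a =>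
          induction h using AddMonoidAlgebra.induction_linear with
          | zero => simp
          | add x y hx hy => rw [mul_add, map_add, hx, hy, map_add]; ring
          | single v b =>
            simp only [AddMonoidAlgebra.single_mul_single, euler_single,
              ← AddMonoidAlgebra.single_add]
            congr 1
            simp only [Pi.add_apply, Pi.zero_apply]
            push_cast
            ring
      refine LinearMap.ext fun h => ?_
      simp [leibniz]
  | algebraMap c => exact ⟨0, algebraMap k _ c, by ext; simp [Algebra.smul_def]⟩
  | add x y _ _ hx hy =>
    obtain ⟨n, hn⟩ := hx
    obtain ⟨n', hn'⟩ := hy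
    exact ⟨max n n', (hn.mono (le_max_left _ _)).add (hn'.mono (le_max_right _ _))⟩
  | mul x y _ _ hx hy =>
    obtain ⟨n, hn⟩ := hx
    obtain ⟨n', hn'⟩ := hy
    exact ⟨n + n', hn.mul hn'⟩

end IsDiffOp

/-! ### Differential operators on the semigroup ring -/

section toric

variable {k : Type*} [Field k] {d m r : ℕ} {A : Matrix (Fin d) (Fin m) ℤ}
  {β : Fin r → Fin d → ℤ}

theorem single_mem_toricRing {u : Fin d → ℤ} (hu : u ∈ semigroup A) (a : k) :
    (AddMonoidAlgebra.single u a : Laurent k d) ∈ toricRing k A :=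
  ⟨AddMonoidAlgebra.single ⟨u, hu⟩ a, by
    simp [AddMonoidAlgebra.mapDomainAlgHom]⟩

theorem mem_semigroup_of_coeff_ne_zero {g : Laurent k d} (hg : g ∈ toricRing k A)
    {u : Fin d → ℤ} (hu : g.coeff u ≠ 0) : u ∈ semigroup A := by
  obtain ⟨x, rfl⟩ := hg
  by_contra hcon
  refine hu (Finsupp.mapDomain_of_notMem_range _ _ ?_)
  rintro ⟨y, rfl⟩
  exact hcon y.2

/-- An operator that `D_A` provides is a sum of homogeneous operators `y^v p_v(θ)` for which `p_v`
is divisible by the boundary polynomial of `v`. -/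
theorem exists_of_mem_toricOperators [CharZero k]
    (hspan : AddSubgroup.closure (Set.range A.col) = ⊤) (hnormal : IsNormal A)
    {T : Module.End k (FsModule k d r)} (hT : T ∈ toricOperators k A β) :
    ∃ p : (Fin d → ℤ) →₀ MvPolynomial (Fin d) k, (∀ v, boundary k A v ∣ p v) ∧
      T = p.sum fun v q => monOp (ell k β) v q := by
  obtain ⟨P, -, δ, hδ, hP⟩ := hT
  obtain ⟨p, hp⟩ := exists_finsupp_of_mem_weylGraph hδ
  have h1 : p.sum (fun v q => monOp 0 v q) = δ := by
    refine Eq.trans ?_ (congrArg Prod.fst hp)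
    rw [Finsupp.sum, Finsupp.sum, Prod.fst_sum]; rfl
  have h2 : p.sum (fun v q => monOp (ell k β) v q) = T := by
    refine Eq.trans ?_ (congrArg Prod.snd hp)
    rw [Finsupp.sum, Finsupp.sum, Prod.snd_sum]; rfl
  refine ⟨p, fun v => boundary_dvd hspan hnormal fun u hu huv => ?_, h2.symm⟩
  by_contra hne
  refine huv (mem_semigroup_of_coeff_ne_zero (k := k) (P ⟨_, single_mem_toricRing hu 1⟩).2 ?_)
  rw [← hP, ← h1, Finsupp.sum, LinearMap.sum_apply, AddMonoidAlgebra.coeff_sum,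
    Finsupp.finsetSum_apply]
  have hv : v ∈ p.support := by
    rw [Finsupp.mem_support_iff]
    intro h0
    rw [h0, map_zero] at hne
    exact hne rfl
  rw [Finset.sum_eq_single_of_mem v hv]
  · simpa [monOp_single] using hne
  · intro w _ hw
    rw [monOp_single, AddMonoidAlgebra.coeff_single, Finsupp.single_apply,
      if_neg (by simpa using hw)]

/-- The operator `y^v p_v(θ)`, for the boundary polynomial `p_v` of `v`, preserves the semigroup
ring, and thus comes from `D_A`. -/
theorem monOp_boundary_mem_toricOperators
    (hspan : AddSubgroup.closure (Set.range A.col) = ⊤) (hnormal : IsNormal A)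
    (v : Fin d → ℤ) : monOp (ell k β) v (boundary k A v) ∈ toricOperators k A β := by
  have hmem := monPair_mem_weylGraph (β := β) v (boundary k A v)
  have hpres : ∀ g ∈ toricRing k A, monOp 0 v (boundary k A v) g ∈ toricRing k A := by
    intro g hg
    rw [← AddMonoidAlgebra.sum_coeff_single g, Finsupp.sum, map_sum]
    refine sum_mem fun u hu => ?_
    have hu' := mem_semigroup_of_coeff_ne_zero hg (Finsupp.mem_support_iff.1 hu)
    rw [monOp_single]
    by_cases huv : u + v ∈ semigroup A
    · exact single_mem_toricRing huv _
    · have := aeval_boundary_eq_zero (k := k) hspan hnormal hu' huv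
      simp [this]
  let P : Module.End k (toricRing k A) :=
    { toFun := fun g => ⟨monOp 0 v (boundary k A v) g, hpres g g.2⟩
      map_add' := fun g h => Subtype.ext (map_add (monOp 0 v (boundary k A v)) _ _)
      map_smul' := fun c g => Subtype.ext (map_smul (monOp 0 v (boundary k A v)) c _) }
  obtain ⟨n, hn⟩ := isDiffOp_of_mem_weylGraph hmem
  exact ⟨P, ⟨n, hn.restrict fun g => rfl⟩, _, hmem, fun g => rfl⟩

end toric

/-! ### The combinatorial ideal, shifted along the grading -/

section generator

variable {k : Type*} [Field k] {d m r : ℕ} {A : Matrix (Fin d) (Fin m) ℤ}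
  {β : Fin r → Fin d → ℤ}

/-- The polynomial `∏_{c_i < 0} s_i (s_i - 1) ⋯ (s_i + c_i + 1)`: up to a constant, the first
factor of `g_c`. -/
def falling (k : Type*) [Field k] {r : ℕ} (c : Fin r → ℤ) : SPoly k r :=
  ∏ i, rise (MvPolynomial.X i) (c i) 0

/-- The polynomial `∏_σ ∏_{F_σ(w) < x ≤ F_σ(ℓ_β(c))} (F_σ(ℓ_β(s)) + x)`. For `w = 0` it is, up to a
constant, the second factor of `g_c`. -/
def facetFactor (k : Type*) [Field k] {d m r : ℕ} (A : Matrix (Fin d) (Fin m) ℤ)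
    (β : Fin r → Fin d → ℤ) (c : Fin r → ℤ) (w : Fin d → ℤ) : SPoly k r :=
  ∏ σ ∈ facets A, rise (supportEval A σ (ell k β)) (supportFunction A σ ⬝ᵥ w)
    (supportFunction A σ ⬝ᵥ ellInt β c)

/-- The ideal of `k[s]` of the coefficients at `y^w` that `D_A[s_{ij}]` can produce from the
elements `t_l ∏ f_i^{s_i}`. -/
def shiftedIdeal (k : Type*) [Field k] {d m r : ℕ} (A : Matrix (Fin d) (Fin m) ℤ)
    (β : Fin r → Fin d → ℤ) (w : Fin d → ℤ) : Ideal (SPoly k r) :=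
  Ideal.span {g | ∃ c : Fin r → ℤ, ∑ i, c i = 1 ∧ g = falling k c * facetFactor k A β c w}

theorem binom_eq (p : SPoly k r) (n : ℕ) :
    binom p n = MvPolynomial.C ((n.factorial : k)⁻¹) * rise p (-n) 0 := by
  rw [binom, prod_range_sub_eq_rise]

theorem binom_zero (p : SPoly k r) : binom p 0 = 1 := by simp [binom]

theorem supportEval_add_int (σ : Finset (Fin m)) (w : Fin d → SPoly k r) (v : Fin d → ℤ) :
    supportEval A σ (w + fun j => (v j : SPoly k r)) =
      supportEval A σ w + ((supportFunction A σ ⬝ᵥ v : ℤ) : SPoly k r) := by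
  rw [supportEval, dotProduct_add, supportEval]
  simp [dotProduct]

/-- The generators `g_c` agree with the products of shifts up to the factorials. -/
theorem exists_generator_eq [CharZero k] (c : Fin r → ℤ) :
    ∃ a : k, a ≠ 0 ∧
      generator k A β c = MvPolynomial.C a * (falling k c * facetFactor k A β c 0) := by
  have h1 : (∏ i with c i < 0, binom (MvPolynomial.X i : SPoly k r) (-c i).toNat) =
      MvPolynomial.C (∏ i, (((-c i).toNat.factorial : k)⁻¹)) * falling k c := by
    rw [Finset.prod_filter_of_ne, map_prod, falling, ← Finset.prod_mul_distrib]
    · refine Finset.prod_congr rfl fun i _ => ?_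
      rw [binom_eq]
      congr 1
      rcases le_total (c i) 0 with h | h
      · congr 1; omega
      · rw [rise_of_le _ h, rise_of_le]; omega
    · intro i _ hne
      by_contra hcon
      rw [Int.toNat_of_nonpos (by omega), binom_zero] at hne
      exact hne rfl
  have h2 : (∏ σ ∈ facets A with 0 < supportFunction A σ ⬝ᵥ ellInt β c,
      binom (supportEval A σ (ell k β + fun j => (ellInt β c j : SPoly k r)))
        (supportFunction A σ ⬝ᵥ ellInt β c).toNat) =
      MvPolynomial.C (∏ σ ∈ facets A,
        (((supportFunction A σ ⬝ᵥ ellInt β c).toNat.factorial : k)⁻¹)) *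
          facetFactor k A β c 0 := by
    rw [Finset.prod_filter_of_ne, map_prod, facetFactor, ← Finset.prod_mul_distrib]
    · refine Finset.prod_congr rfl fun σ _ => ?_
      rw [binom_eq, supportEval_add_int, rise_add_intCast, dotProduct_zero]
      congr 1
      rcases le_total 0 (supportFunction A σ ⬝ᵥ ellInt β c) with h | h
      · congr 1 <;> omega
      · rw [rise_of_le _ h, rise_of_le]; omega
    · intro σ _ hne
      by_contra hcon
      rw [Int.toNat_of_nonpos (not_lt.1 hcon), binom_zero] at hne
      exact hne rfl
  have hfac : ∀ n : ℕ, ((n.factorial : k)⁻¹) ≠ 0 := fun n =>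
    inv_ne_zero (Nat.cast_ne_zero.2 n.factorial_ne_zero)
  refine ⟨(∏ i, (((-c i).toNat.factorial : k)⁻¹)) * ∏ σ ∈ facets A,
    (((supportFunction A σ ⬝ᵥ ellInt β c).toNat.factorial : k)⁻¹), ?_, ?_⟩
  · exact mul_ne_zero (Finset.prod_ne_zero_iff.2 fun i _ => hfac _)
      (Finset.prod_ne_zero_iff.2 fun σ _ => hfac _)
  rw [generator, h1, h2, map_mul, mul_mul_mul_comm]

theorem shiftedIdeal_zero [CharZero k] : shiftedIdeal k A β 0 = combinatorialIdeal k A β := by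
  apply le_antisymm
  · refine Ideal.span_le.2 ?_
    rintro _ ⟨c, hc, rfl⟩
    obtain ⟨a, ha, h⟩ := exists_generator_eq (k := k) (A := A) (β := β) c
    have : falling k c * facetFactor k A β c 0 = MvPolynomial.C a⁻¹ * generator k A β c := by
      rw [h, ← mul_assoc, ← map_mul, inv_mul_cancel₀ ha, map_one, one_mul]
    rw [this]
    exact Ideal.mul_mem_left _ _ (Ideal.subset_span ⟨c, hc, rfl⟩)
  · refine Ideal.span_le.2 ?_
    rintro _ ⟨c, hc, rfl⟩
    obtain ⟨a, -, h⟩ := exists_generator_eq (k := k) (A := A) (β := β) c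
    rw [h]
    exact Ideal.mul_mem_left _ _ (Ideal.subset_span ⟨c, hc, rfl⟩)

theorem aeval_boundary (v w : Fin d → ℤ) :
    MvPolynomial.aeval (fun j => (w j : SPoly k r) + ell k β j) (boundary k A v) =
      ∏ σ ∈ facets A, rise (supportEval A σ (ell k β)) (supportFunction A σ ⬝ᵥ (w + v))
        (supportFunction A σ ⬝ᵥ w) := by
  rw [boundary, map_prod]
  refine Finset.prod_congr rfl fun σ _ => ?_
  rw [map_rise, map_linForm]
  simp only [MvPolynomial.aeval_X]
  have : ((fun j => (supportFunction A σ j : SPoly k r)) ⬝ᵥ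
      fun j => (w j : SPoly k r) + ell k β j) =
        supportEval A σ (ell k β) + ((supportFunction A σ ⬝ᵥ w : ℤ) : SPoly k r) := by
    rw [← supportEval_add_int, add_comm]; rfl
  rw [this, rise_add_intCast, dotProduct_add, zero_add, add_comm]

end generator

/-! ### The operators `t_i` and `s_{ij}` -/

section sij

variable {k : Type*} [Field k] {d m r : ℕ} {A : Matrix (Fin d) (Fin m) ℤ}
  {β : Fin r → Fin d → ℤ}

/-- The substitution `s_j ↦ s_j + 1`, `s_i ↦ s_i - 1` effected by `t_i⁻¹ t_j`. -/
def shiftPair (k : Type*) [Field k] {r : ℕ} (i j : Fin r) : SPoly k r →ₐ[k] SPoly k r :=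
  (shift k i (-1)).comp (shift k j 1)

/-- The exponent vector of `t_i⁻¹ t_j`. -/
def exchange {r : ℕ} (i j : Fin r) : Fin r → ℤ := Pi.single j 1 - Pi.single i 1

theorem tOp_single (i : Fin r) (n : ℤ) (w : Fin d → ℤ) (g : SPoly k r) :
    tOp k β i n (AddMonoidAlgebra.single w g) =
      AddMonoidAlgebra.single (n • β i + w) (shift k i n g) := by
  simp [tOp, AddMonoidAlgebra.single_mul_single]

theorem tOp_one_one (l : Fin r) :
    tOp k β l 1 1 = (AddMonoidAlgebra.single (β l) 1 : FsModule k d r) := by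
  rw [AddMonoidAlgebra.one_def, tOp_single, map_one, one_smul, add_zero]

theorem sijOp_single (i j : Fin r) (w : Fin d → ℤ) (g : SPoly k r) :
    sijOp k β i j (AddMonoidAlgebra.single w g) =
      AddMonoidAlgebra.single (w + (β j - β i)) (MvPolynomial.X i * shiftPair k i j g) := by
  rw [sijOp, Module.End.mul_apply, Module.End.mul_apply, tOp_single, tOp_single, sOp,
    Algebra.lsmul_coe]
  beta_reduce
  rw [AddMonoidAlgebra.smul_single, smul_eq_mul, shiftPair, AlgHom.comp_apply]
  congr 1
  rw [neg_one_smul, one_smul]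
  abel

theorem shiftPair_X (i j l : Fin r) :
    shiftPair k i j (MvPolynomial.X l) = MvPolynomial.X l + (exchange i j l : SPoly k r) := by
  simp only [shiftPair, AlgHom.comp_apply, shift, MvPolynomial.aeval_X, map_add, exchange,
    Pi.sub_apply, Pi.single_apply, apply_ite (MvPolynomial.aeval _), map_intCast, map_zero]
  push_cast
  split_ifs <;> ring

theorem shiftPair_self (i : Fin r) : shiftPair k i i = AlgHom.id k _ := by
  ext l : 1
  rw [shiftPair_X, exchange, sub_self]
  simp

theorem ellInt_add (c c' : Fin r → ℤ) : ellInt β (c + c') = ellInt β c + ellInt β c' := by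
  simp [ellInt, add_smul, Finset.sum_add_distrib]

theorem ellInt_exchange (i j : Fin r) : ellInt β (exchange i j) = β j - β i := by
  simp [ellInt, exchange, sub_smul, Finset.sum_sub_distrib, Pi.single_apply]

theorem sum_exchange (i j : Fin r) : ∑ l, exchange i j l = 0 := by
  simp [exchange, Finset.sum_sub_distrib, Pi.single_apply]

theorem shiftPair_falling (i j : Fin r) (c : Fin r → ℤ) :
    shiftPair k i j (falling k c) =
      ∏ l, rise (MvPolynomial.X l) ((c + exchange i j) l) (exchange i j l) := by
  rw [falling, map_prod]
  refine Finset.prod_congr rfl fun l _ => ?_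
  rw [map_rise, shiftPair_X, rise_add_intCast, zero_add]; rfl

theorem shiftPair_supportEval (i j : Fin r) (σ : Finset (Fin m)) :
    shiftPair k i j (supportEval A σ (ell k β)) =
      supportEval A σ (ell k β) + ((supportFunction A σ ⬝ᵥ (β j - β i) : ℤ) : SPoly k r) := by
  rw [← supportEval_add_int, ← ellInt_exchange]
  simp only [supportEval, dotProduct, map_sum, map_mul, map_intCast]
  refine Finset.sum_congr rfl fun x _ => ?_
  congr 1
  simp only [ell, ellInt, map_sum, map_mul, map_intCast, shiftPair_X, add_mul,
    Finset.sum_add_distrib, Pi.add_apply, Finset.sum_apply, Pi.smul_apply, smul_eq_mul]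
  push_cast
  rfl

theorem shiftPair_facetFactor (i j : Fin r) (c : Fin r → ℤ) (w : Fin d → ℤ) :
    shiftPair k i j (facetFactor k A β c w) =
      facetFactor k A β (c + exchange i j) (w + (β j - β i)) := by
  rw [facetFactor, map_prod]
  refine Finset.prod_congr rfl fun σ _ => ?_
  rw [map_rise, shiftPair_supportEval, rise_add_intCast, ellInt_add, ellInt_exchange,
    dotProduct_add, dotProduct_add]

theorem prod_rise_exchange_dvd (i j : Fin r) :
    ∏ l, rise (MvPolynomial.X l : SPoly k r) (exchange i j l) 0 ∣ MvPolynomial.X i := by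
  rw [Finset.prod_eq_single i]
  · rcases eq_or_ne i j with rfl | hij
    · rw [exchange, sub_self, Pi.zero_apply, rise_of_le _ le_rfl]
      exact one_dvd _
    · have : exchange i j i = 0 - 1 := by simp [exchange, hij]
      rw [this, rise_pred_self]
      simp
  · intro l _ hl
    refine rise_of_le _ ?_
    by_cases h : l = j <;> simp [exchange, hl, h, Pi.single_apply]
    split_ifs <;> omega
  · simp

theorem falling_dvd_mul_shiftPair (i j : Fin r) (c : Fin r → ℤ) :
    falling k (c + exchange i j) ∣ MvPolynomial.X i * shiftPair k i j (falling k c) := by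
  have h : falling k (c + exchange i j) ∣
      (∏ l, rise (MvPolynomial.X l) ((c + exchange i j) l) (exchange i j l)) *
        ∏ l, rise (MvPolynomial.X l : SPoly k r) (exchange i j l) 0 := by
    rw [← Finset.prod_mul_distrib]
    exact Finset.prod_dvd_prod_of_dvd _ _ fun l _ => rise_dvd_mul _ _ _ _
  rw [shiftPair_falling, mul_comm]
  exact h.trans (mul_dvd_mul_left _ (prod_rise_exchange_dvd i j))

end sij

/-! ### Functional equations lie in the combinatorial ideal -/

section forward

variable {k : Type*} [Field k] {d m r : ℕ} {A : Matrix (Fin d) (Fin m) ℤ}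
  {β : Fin r → Fin d → ℤ}

/-- The subspace of the `u` whose coefficient at each `y^w` lies in the shifted ideal of `w`. -/
def idealModule (k : Type*) [Field k] {d m r : ℕ} (A : Matrix (Fin d) (Fin m) ℤ)
    (β : Fin r → Fin d → ℤ) : Submodule k (FsModule k d r) where
  carrier := {u | ∀ w, u.coeff w ∈ shiftedIdeal k A β w}
  add_mem' hu hv w := add_mem (hu w) (hv w)
  zero_mem' _ := zero_mem _
  smul_mem' a u hu w := by
    rw [AddMonoidAlgebra.coeff_smul_apply]
    exact Submodule.smul_of_tower_mem _ a (hu w)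

theorem single_mem_idealModule {w : Fin d → ℤ} {g : SPoly k r}
    (hg : g ∈ shiftedIdeal k A β w) :
    (AddMonoidAlgebra.single w g : FsModule k d r) ∈ idealModule k A β := by
  intro w'
  rw [AddMonoidAlgebra.coeff_single, Finsupp.single_apply]
  split_ifs with h
  · exact h ▸ hg
  · exact zero_mem _

theorem map_mem_idealModule {T : Module.End k (FsModule k d r)}
    (hT : ∀ (w : Fin d → ℤ) (c : Fin r → ℤ) (h : SPoly k r), ∑ i, c i = 1 →
      T (AddMonoidAlgebra.single w (h * (falling k c * facetFactor k A β c w))) ∈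
        idealModule k A β)
    {u : FsModule k d r} (hu : u ∈ idealModule k A β) : T u ∈ idealModule k A β := by
  rw [← AddMonoidAlgebra.sum_coeff_single u, Finsupp.sum, map_sum]
  refine sum_mem fun w _ => ?_
  have key : ∀ g ∈ shiftedIdeal k A β w, ∀ h : SPoly k r,
      T (AddMonoidAlgebra.single w (h * g)) ∈ idealModule k A β := by
    intro g hg
    induction hg using Submodule.span_induction with
    | mem g hg => obtain ⟨c, hc, rfl⟩ := hg; exact fun h => hT w c h hc
    | zero => intro h; simp
    | add g g' _ _ hg hg' =>
      intro h
      rw [mul_add, AddMonoidAlgebra.single_add, map_add]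
      exact add_mem (hg h) (hg' h)
    | smul a g _ hg => intro h; rw [smul_eq_mul, ← mul_assoc]; exact hg _
  simpa using key _ (hu w) 1

theorem monOp_mem_idealModule {v : Fin d → ℤ} {p : MvPolynomial (Fin d) k}
    (hp : boundary k A v ∣ p) {u : FsModule k d r} (hu : u ∈ idealModule k A β) :
    monOp (ell k β) v p u ∈ idealModule k A β := by
  refine map_mem_idealModule (fun w c h hc => ?_) hu
  rw [monOp_single]
  refine single_mem_idealModule (Ideal.mem_of_dvd _ ?_ (Ideal.subset_span ⟨c, hc, rfl⟩))
  -- the boundary factors extend the interval `(F_σ(w), F_σ(ℓ_β(c))]` down to `F_σ(w + v)`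
  have h1 : facetFactor k A β c (w + v) ∣
      MvPolynomial.aeval (fun j => (w j : SPoly k r) + ell k β j) p * facetFactor k A β c w := by
    refine Dvd.dvd.trans ?_ (mul_dvd_mul_right (map_dvd (MvPolynomial.aeval _) hp) _)
    rw [aeval_boundary, facetFactor, facetFactor, ← Finset.prod_mul_distrib]
    exact Finset.prod_dvd_prod_of_dvd _ _ fun σ _ => rise_dvd_mul _ _ _ _
  obtain ⟨q, hq⟩ := h1
  refine ⟨h * q, ?_⟩
  linear_combination (h * falling k c) * hq

theorem sijOp_mem_idealModule (i j : Fin r) {u : FsModule k d r}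
    (hu : u ∈ idealModule k A β) : sijOp k β i j u ∈ idealModule k A β := by
  refine map_mem_idealModule (fun w c h hc => ?_) hu
  rw [sijOp_single]
  refine single_mem_idealModule (Ideal.mem_of_dvd _ ?_
    (Ideal.subset_span ⟨c + exchange i j, ?_, rfl⟩))
  · obtain ⟨q, hq⟩ := falling_dvd_mul_shiftPair (k := k) i j c
    refine ⟨shiftPair k i j h * q, ?_⟩
    rw [map_mul, map_mul, shiftPair_facetFactor]
    linear_combination (shiftPair k i j h *
      facetFactor k A β (c + exchange i j) (w + (β j - β i))) * hq
  · simp only [Pi.add_apply, Finset.sum_add_distrib, hc, sum_exchange, add_zero]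

theorem bsOperators_mem_idealModule [CharZero k]
    (hspan : AddSubgroup.closure (Set.range A.col) = ⊤) (hnormal : IsNormal A)
    {T : Module.End k (FsModule k d r)} (hT : T ∈ bsOperators k A β) {u : FsModule k d r}
    (hu : u ∈ idealModule k A β) : T u ∈ idealModule k A β := by
  induction hT using Algebra.adjoin_induction generalizing u with
  | mem T hT =>
    rcases hT with hT | ⟨⟨i, j⟩, rfl⟩
    · obtain ⟨p, hp, rfl⟩ := exists_of_mem_toricOperators hspan hnormal hT
      rw [Finsupp.sum, LinearMap.sum_apply]
      exact sum_mem fun v _ => monOp_mem_idealModule (hp v) hu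
    · exact sijOp_mem_idealModule i j hu
  | algebraMap a => exact Submodule.smul_mem _ a hu
  | add T T' _ _ h h' => exact add_mem (h hu) (h' hu)
  | mul T T' _ _ h h' => exact h (h' hu)

theorem tOp_one_mem_idealModule (l : Fin r) :
    (tOp k β l 1 1 : FsModule k d r) ∈ idealModule k A β := by
  rw [tOp_one_one]
  refine single_mem_idealModule (Ideal.subset_span ⟨Pi.single l 1, by simp, ?_⟩)
  have h1 : falling k (Pi.single l 1 : Fin r → ℤ) = 1 := by
    refine Finset.prod_eq_one fun i _ => rise_of_le _ ?_
    rw [Pi.single_apply]; split_ifs <;> simp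
  have h2 : ellInt β (Pi.single l 1) = β l := by
    simp [ellInt, Pi.single_apply]
  rw [h1, facetFactor, h2, one_mul]
  exact (Finset.prod_eq_one fun σ _ => rise_of_le _ le_rfl).symm

theorem mem_combinatorialIdeal_of_functionalEquation [CharZero k]
    (hspan : AddSubgroup.closure (Set.range A.col) = ⊤) (hnormal : IsNormal A)
    {b : Polynomial k} (h : FunctionalEquation A β b) :
    evalSum r b ∈ combinatorialIdeal k A β := by
  obtain ⟨P, hP, hb⟩ := h
  have hmem : evalSum r b • (1 : FsModule k d r) ∈ idealModule k A β := by
    rw [hb]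
    exact sum_mem fun l _ =>
      bsOperators_mem_idealModule hspan hnormal (hP l) (tOp_one_mem_idealModule l)
  have := hmem 0
  rw [shiftedIdeal_zero, AddMonoidAlgebra.one_def, AddMonoidAlgebra.smul_single,
    AddMonoidAlgebra.coeff_single, Finsupp.single_eq_same, smul_eq_mul, mul_one] at this
  exact this

end forward

/-! ### Elements of the combinatorial ideal give functional equations -/

section backward

variable {k : Type*} [Field k] {d m r : ℕ} {A : Matrix (Fin d) (Fin m) ℤ}
  {β : Fin r → Fin d → ℤ}

/-- The `D_A[s_{ij}]`-submodule generated by the elements `t_l ∏ f_i^{s_i}`. -/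
def bsModule (k : Type*) [Field k] {d m r : ℕ} (A : Matrix (Fin d) (Fin m) ℤ)
    (β : Fin r → Fin d → ℤ) : Submodule (bsOperators k A β) (FsModule k d r) :=
  Submodule.span _ (Set.range fun l => tOp k β l 1 1)

theorem apply_mem_bsModule {T : Module.End k (FsModule k d r)} (hT : T ∈ bsOperators k A β)
    {u : FsModule k d r} (hu : u ∈ bsModule k A β) : T u ∈ bsModule k A β :=
  (bsModule k A β).smul_mem (⟨T, hT⟩ : bsOperators k A β) hu

theorem functionalEquation_iff {b : Polynomial k} :
    FunctionalEquation A β b ↔ evalSum r b • (1 : FsModule k d r) ∈ bsModule k A β := by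
  rw [bsModule, Submodule.mem_span_range_iff_exists_fun]
  constructor
  · rintro ⟨P, hP, h⟩
    exact ⟨fun l => ⟨P l, hP l⟩, h.symm⟩
  · rintro ⟨P, h⟩
    exact ⟨fun l => P l, fun l => (P l).2, h.symm⟩

theorem sijOp_mem_bsOperators (i j : Fin r) : sijOp k β i j ∈ bsOperators k A β :=
  Algebra.subset_adjoin (Or.inr ⟨(i, j), rfl⟩)

/-- The submodule is stable under multiplication by `k[s]`, as `s_i = s_{ii}`. -/
theorem single_mul_mem_bsModule {w : Fin d → ℤ} {g : SPoly k r}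
    (hg : (AddMonoidAlgebra.single w g : FsModule k d r) ∈ bsModule k A β) (h : SPoly k r) :
    (AddMonoidAlgebra.single w (h * g) : FsModule k d r) ∈ bsModule k A β := by
  induction h using MvPolynomial.induction_on with
  | C a =>
    have := apply_mem_bsModule (algebraMap_mem (bsOperators k A β) a) hg
    rwa [Module.algebraMap_end_apply, AddMonoidAlgebra.smul_single, MvPolynomial.smul_eq_C_mul]
      at this
  | add p q hp hq => rw [add_mul, AddMonoidAlgebra.single_add]; exact add_mem hp hq
  | mul_X p i hp =>
    have := apply_mem_bsModule (sijOp_mem_bsOperators i i) hp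
    rwa [sijOp_single, shiftPair_self, sub_self, add_zero, AlgHom.id_apply, ← mul_assoc,
      mul_comm (MvPolynomial.X i)] at this

theorem mul_shiftPair_falling {i j : Fin r} {c : Fin r → ℤ} (hi : (c + exchange i j) i < 0)
    (hj : 0 < (c + exchange i j) j) :
    MvPolynomial.X i * shiftPair k i j (falling k c) = falling k (c + exchange i j) := by
  have hij : i ≠ j := by rintro rfl; omega
  rw [shiftPair_falling, falling, ← Finset.mul_prod_erase _ _ (Finset.mem_univ i),
    ← Finset.mul_prod_erase (a := i) _ _ (Finset.mem_univ i), ← mul_assoc]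
  congr 1
  · have h1 : exchange i j i = 0 - 1 := by simp [exchange, hij]
    rw [h1, ← rise_mul_rise _ (a := (c + exchange i j) i) (b := 0 - 1) (c := 0) (by omega)
      (by omega), rise_pred_self, mul_comm]
    simp
  · refine Finset.prod_congr rfl fun l hl => ?_
    have hli := Finset.ne_of_mem_erase hl
    rcases eq_or_ne l j with rfl | hlj
    · have h1 : exchange i l l = 1 := by simp [exchange, hli]
      rw [rise_of_le _ hj.le, rise_of_le]
      omega
    · have h1 : exchange i j l = 0 := by simp [exchange, hli, hlj]
      rw [h1]

/-- The elements `∏_{c_i < 0} s_i (s_i - 1) ⋯ (s_i + c_i + 1) y^{ℓ_β(c)}` with `∑ c_i = 1` are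
obtained from the `t_l ∏ f_i^{s_i}` by repeatedly applying operators `s_{ij}` with
`c_i < 0 < c_j`. -/
theorem falling_mem_bsModule {c : Fin r → ℤ} (hc : ∑ i, c i = 1) :
    (AddMonoidAlgebra.single (ellInt β c) (falling k c) : FsModule k d r) ∈ bsModule k A β := by
  induction hn : ∑ i, (-c i).toNat using Nat.strong_induction_on generalizing c with
  | _ n ih =>
  by_cases hneg : ∃ i, c i < 0
  · obtain ⟨i, hi⟩ := hneg
    obtain ⟨j, hj⟩ : ∃ j, 0 < c j := by
      by_contra! hcon
      have := Finset.sum_nonpos fun j (_ : j ∈ Finset.univ) => hcon j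
      omega
    have hij : i ≠ j := by rintro rfl; omega
    set c' := c - exchange i j with hc'
    have hcc : c = c' + exchange i j := by rw [hc', sub_add_cancel]
    have hsum : ∑ l, c' l = 1 := by
      simp only [hc', Pi.sub_apply, Finset.sum_sub_distrib, hc, sum_exchange, sub_zero]
    have hlt : ∑ l, (-c' l).toNat < n := by
      rw [← hn]
      have hv : ∀ l, c' l = c l - ((if l = j then 1 else 0) - if l = i then 1 else 0) := by
        intro l; simp [hc', exchange, Pi.single_apply]
      refine Finset.sum_lt_sum (fun l _ => ?_) ⟨i, Finset.mem_univ i, ?_⟩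
      · rw [hv]
        by_cases hlj : l = j
        · subst hlj; simp only [if_true, if_neg hij.symm]; omega
        · rw [if_neg hlj]; split_ifs <;> omega
      · rw [hv, if_neg hij, if_pos rfl]; omega
    have := apply_mem_bsModule (sijOp_mem_bsOperators i j) (ih _ hlt hsum rfl)
    rwa [sijOp_single, mul_shiftPair_falling (by rwa [← hcc]) (by rwa [← hcc]), ← hcc,
      ← ellInt_exchange, ← ellInt_add, ← hcc] at this
  · push Not at hneg
    obtain ⟨l, hl⟩ : ∃ l, 0 < c l := by
      by_contra! hcon
      have := Finset.sum_nonpos fun j (_ : j ∈ Finset.univ) => hcon j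
      omega
    have hcl : c = Pi.single l 1 := by
      have hs := Finset.add_sum_erase Finset.univ c (Finset.mem_univ l)
      have h0 : 0 ≤ ∑ x ∈ Finset.univ.erase l, c x := Finset.sum_nonneg fun x _ => hneg x
      have h1 : ∑ x ∈ Finset.univ.erase l, c x = 0 := by omega
      have h2 := (Finset.sum_eq_zero_iff_of_nonneg fun x _ => hneg x).1 h1
      ext x
      rcases eq_or_ne x l with rfl | hx
      · rw [Pi.single_eq_same]; omega
      · rw [Pi.single_eq_of_ne hx]; exact h2 x (Finset.mem_erase.2 ⟨hx, Finset.mem_univ x⟩)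
    have h1 : falling k c = 1 := Finset.prod_eq_one fun i _ => rise_of_le _ (hneg i)
    have h2 : ellInt β c = β l := by rw [hcl]; simp [ellInt, Pi.single_apply]
    rw [h1, h2, ← tOp_one_one]
    exact Submodule.subset_span ⟨l, rfl⟩

theorem functionalEquation_of_mem_combinatorialIdeal [CharZero k]
    (hspan : AddSubgroup.closure (Set.range A.col) = ⊤) (hnormal : IsNormal A)
    {b : Polynomial k} (h : evalSum r b ∈ combinatorialIdeal k A β) :
    FunctionalEquation A β b := by
  rw [functionalEquation_iff, AddMonoidAlgebra.one_def, AddMonoidAlgebra.smul_single, smul_eq_mul,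
    mul_one]
  rw [← shiftedIdeal_zero] at h
  generalize evalSum r b = g at h
  suffices ∀ a : SPoly k r, (AddMonoidAlgebra.single 0 (a * g) : FsModule k d r) ∈ bsModule k A β by
    simpa using this 1
  induction h using Submodule.span_induction with
  | mem g hg =>
    obtain ⟨c, hc, rfl⟩ := hg
    refine single_mul_mem_bsModule ?_
    -- the operator of degree `-ℓ_β(c)` moves `y^{ℓ_β(c)}` back to `1`
    have := apply_mem_bsModule (A := A) (Algebra.subset_adjoin (Or.inl
      (monOp_boundary_mem_toricOperators (β := β) hspan hnormal (-ellInt β c))))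
      (falling_mem_bsModule (k := k) hc)
    rw [monOp_single, aeval_boundary, add_neg_cancel, mul_comm] at this
    exact this
  | zero => intro a; simp
  | add g g' _ _ hg hg' =>
    intro a
    rw [mul_add, AddMonoidAlgebra.single_add]
    exact add_mem (hg a) (hg' a)
  | smul a g _ hg => intro a'; rw [smul_eq_mul, ← mul_assoc]; exact hg _

end backward

end ToricBS

end

theorem mainTheorem5 {k : Type*} [Field k] [IsAlgClosed k] [CharZero k] {d m r : ℕ}
    (A : Matrix (Fin d) (Fin m) ℤ)
    (hspan : AddSubgroup.closure (Set.range A.col) = ⊤)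
    (hpointed : (ToricBS.cone A : ConvexCone ℝ (Fin d → ℝ)).Salient)
    (hnormal : ToricBS.IsNormal A)
    (β : Fin r → Fin d → ℤ) (hβ : ∀ i, β i ∈ ToricBS.semigroup A)
    (b : Polynomial k) :
    ToricBS.IsBernsteinSato A β b ↔
      ToricBS.IsMonicOfLeastDegree
        (fun p => ToricBS.evalSum r p ∈ ToricBS.combinatorialIdeal k A β) b := by
  have key : ToricBS.FunctionalEquation A β =
      fun p : Polynomial k => ToricBS.evalSum r p ∈ ToricBS.combinatorialIdeal k A β :=
    funext fun p => propext
      ⟨ToricBS.mem_combinatorialIdeal_of_functionalEquation hspan hnormal,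
        ToricBS.functionalEquation_of_mem_combinatorialIdeal hspan hnormal⟩
  rw [ToricBS.IsBernsteinSato, key]
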